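/- **Setting.** Let $\mathcal V,\mathcal X,\mathcal Y$ be finite alphabets, $P_V$ a distribution on $\mathcal V$ (memoryless source $P^k(\boldsymbol v)=\prod_s P_V(v_s)$) and $W(\cdot|\cdot)$ a discrete memoryless channel from $\mathcal X$ to $\mathcal Y$. Logarithms are natural, $|a|^+=\max(a,0)$. The type of a sequence is its empirical distribution, and the type class $\mathcal T^n(Q)$ is the set of sequences of length $n$ of type $Q$. Messages of length $k$ are sent with blocklength $n$, at rate $t=k/n$; we consider a sequence of pairs $(n,k)$ with $n\to\infty$, $k\ge 1$ and $k/n$ bounded. Let $P_1,\dots,P_{N_k}$ be the types of sequences in $\mathcal V^k$ and $R_i=tH(P_i)$. For each pair $(n,k)$ the following are given: types $Q_1,\dots,Q_m$ of sequences in $\mathcal X^n$; a map $\mu:\{1,\dots,N_k\}\to\{1,\dots,m\}$; a symmetric function $d(\boldsymbol x,\boldsymbol x')\in\mathbb R$ depending only on the joint type of $(\boldsymbol x,\boldsymbol x')$; real thresholds $\Delta_1,\dots,\Delta_{N_k}$; a type-dependent decoding metric $q(\boldsymbol v,\boldsymbol x,\boldsymbol y)=q(i,\hat P_{\boldsymbol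 x\boldsymbol y})\in[-\infty,\infty]$ for $\boldsymbol v\in\mathcal T^k(P_i)$. **Code ensemble.** Order the source types so that the thresholds $\Delta_i$ are non-increasing along the order (ties in any order), and order the messages inside each type class arbitrarily. The codewords are generated one after another, class by class in this order: the codeword of a message of class $i$ is drawn equiprobably from the set of all $\bar{\boldsymbol x}\in\mathcal T^n(Q_{\mu(i)})$ such that $d(\boldsymbol x,\bar{\boldsymbol x})>\max(\Delta_i,\Delta_j)$ for every earlier codeword $\boldsymbol x$, where $j$ is the class of the message of $\boldsymbol x$. Suppose that, for some $\delta>0$ not depending on $n$, for every $(n,k)$ and every $c\in\{1,\dots,m\}$, $$\sum_{j=1}^{N_k}\ \sum_{\bar{\boldsymbol x}\in\mathcal T^n(Q_c):\ d(\bar{\boldsymbol x},\tilde{\boldsymbol x}_j)\le\Delta_j}|\mathcal T^k(P_j)|\ \le\ \zeta_n\,|\mathcal T^n(Q_c)|\,e^{-n\delta},\qquad \zeta_n=N_k(n+1)^{|\mathcal X|^2+|\mathcal X|},$$ where $\tilde{\boldsymbol x}_j$ is any sequence in $\mathcal T^n(Q_{\mu(j)})$. The decoder outputs a message $\boldsymbol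 v$ that maximizes $q(\boldsymbol v,\boldsymbol x_{\boldsymbol v},\boldsymbol y)$, ties being broken arbitrarily; $\bar p_e$ is its error probability, averaged over the messages, the channel and the code ensemble. **Theorem.** For all sufficiently large $n$ the construction never runs out of sequences (so that the ensemble is a probability distribution on codebooks), and $$\bar p_e\ \dot\le\ \sum_{i=1}^{N_k}\sum_{j=1}^{N_k}\exp\!\big(-nE_{\mathrm{rgv}}^{(ij)}(P_V,W)\big),$$ that is, $\limsup\frac1n\log(\text{left side}/\text{right side})\le 0$ (with $0/0=0$, $\log 0=-\infty$), where $$E_{\mathrm{rgv}}^{(ij)}(P_V,W)=t\,e\!\left(\tfrac{R_i}{t},P_V\right)+\min_{P\in\Gamma_{ij}}\Big\{D\big(P_{XY}\,\|\,Q_{\mu(i)}\times W\big)+\big|I_P(\bar X;X,Y)-R_j\big|^+\Big\},$$ $e(R,P_V)=\min_{Q:\,H(Q)\ge R}D(Q\|P_V)$, and $\Gamma_{ij}$ is the set of joint types $P_{X\bar XY}$ of triples of sequences of length $n$ with $$P_X=Q_{\mu(i)},\quad P_{\bar X}=Q_{\mu(j)},\quad d(P_{X\bar X})\ge\max(\Delta_i,\Delta_j),\quad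 q(i,P_{XY})\le q(j,P_{\bar XY}).$$ A minimum over an empty set is $+\infty$, and $e^{-\infty}=0$. -/

import Mathlib

open Filter Finset

noncomputable section

namespace RGV

/-! ### Method of types -/

/-- The type (empirical distribution) of a sequence. -/
def empType {α : Type*} {n : ℕ} (x : Fin n → α) : α → ℝ :=
  open Classical in fun a => (#{i | x i = a} : ℝ) / n

/-- The joint type of two sequences of the same length. -/
def jointType {α β : Type*} {n : ℕ} (x : Fin n → α) (y : Fin n → β) : α × β → ℝ :=
  empType fun i => (x i, y i)

/-- The set of types of sequences of length `n` over `α`. -/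
abbrev SeqType (n : ℕ) (α : Type*) : Type _ :=
  {P : α → ℝ // ∃ x : Fin n → α, empType x = P}

instance (n : ℕ) (α : Type*) [Finite α] : Finite (SeqType n α) :=
  Set.finite_range (fun x : Fin n → α => empType x)

instance (n : ℕ) (α : Type*) [Fintype α] : Fintype (SeqType n α) :=
  Fintype.ofFinite _

/-- The type of a sequence, as an element of the set of types. -/
def typeOf {α : Type*} {n : ℕ} (x : Fin n → α) : SeqType n α :=
  ⟨empType x, x, rfl⟩

/-- The type class of `Q`: all sequences of length `n` whose type is `Q`. -/
def typeClass {α : Type*} [Fintype α] {n : ℕ} (Q : SeqType n α) : Finset (Fin n → α) :=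
  open Classical in {x | typeOf x = Q}

/-! ### Information measures (natural logarithms) -/

/-- The distribution of `f Z` when `Z` has distribution `P`. -/
def margin {α β : Type*} [Fintype α] (f : α → β) (P : α → ℝ) : β → ℝ :=
  open Classical in fun b => ∑ a with f a = b, P a

/-- Shannon entropy. -/
def entropy {α : Type*} [Fintype α] (P : α → ℝ) : ℝ :=
  ∑ a, Real.negMulLog (P a)

/-- Relative entropy `D(P‖Q)`; it is `∞` unless `P` is absolutely continuous with respect
to `Q`. -/
def relEntropy {α : Type*} [Fintype α] (P Q : α → ℝ) : EReal :=
  open Classical in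
  if ∀ a, Q a = 0 → P a = 0 then ((∑ a, P a * Real.log (P a / Q a) : ℝ) : EReal) else ⊤

/-- Mutual information `I(A;B)` of a joint distribution of `(A, B)`. -/
def mutualInfo {α β : Type*} [Fintype α] [Fintype β] (P : α × β → ℝ) : ℝ :=
  ∑ z, P z * Real.log (P z / (margin Prod.fst P z.1 * margin Prod.snd P z.2))

/-- The source reliability function `e(R, PV) = min {D(Q‖PV) : H(Q) ≥ R}`. -/
def sourceExponent {V : Type*} [Fintype V] (R : ℝ) (PV : V → ℝ) : EReal :=
  ⨅ Q ∈ {Q : V → ℝ | Q ∈ stdSimplex ℝ V ∧ R ≤ entropy Q}, relEntropy Q PV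

/-! ### The recursive random code construction -/

/-- The design parameters of the code construction for source messages of length `k` and
codewords of length `n`. -/
structure Params (V X : Type*) [Fintype V] [Fintype X] (m n k : ℕ) where
  /-- the codeword distributions `Q_1, …, Q_m`, types of sequences of length `n` -/
  Q : Fin m → SeqType n X
  /-- the assignment of a codeword distribution to each source type -/
  μ : SeqType k V → Fin m
  /-- the distance, a function of the joint type -/
  d : (X × X → ℝ) → ℝ
  /-- the distance is symmetric -/
  d_symm : ∀ x x' : Fin n → X, d (jointType x x') = d (jointType x' x)
  /-- the distance thresholds -/
  Δ : SeqType k V → ℝ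
  /-- the ordering of the source types: `rank i` is the position of `i` -/
  rank : SeqType k V ≃ Fin (Fintype.card (SeqType k V))
  /-- the order in which the messages get their codewords: `enum a` is the `a`-th message -/
  enum : Fin (Fintype.card (Fin k → V)) ≃ (Fin k → V)
  /-- codewords are generated class by class, in the order given by `rank` -/
  enum_mono : Monotone fun a => rank (typeOf (enum a))

/-- A codebook: `C a` is the `a`-th generated codeword. -/
abbrev Codebook (V X : Type*) [Fintype V] (n k : ℕ) : Type _ :=
  Fin (Fintype.card (Fin k → V)) → (Fin n → X)

namespace Params

variable {V X : Type*} [Fintype V] [Fintype X] {m n k : ℕ}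

/-- The source type of the `a`-th message. -/
def cls (p : Params V X m n k) (a : Fin (Fintype.card (Fin k → V))) : SeqType k V :=
  typeOf (p.enum a)

/-- The codeword of the message `v`. -/
def codeword (p : Params V X m n k) (C : Codebook V X n k) (v : Fin k → V) : Fin n → X :=
  C (p.enum.symm v)

/-- The set from which the `a`-th codeword is drawn, given the codewords before it: the
sequences of the prescribed type whose distance to each earlier codeword exceeds the larger
of the two thresholds. -/
def drawSet (p : Params V X m n k) (C : Codebook V X n k)
    (a : Fin (Fintype.card (Fin k → V))) : Finset (Fin n → X) :=
  open Classical in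
  {x ∈ typeClass (p.Q (p.μ (p.cls a))) |
    ∀ b, b < a → max (p.Δ (p.cls a)) (p.Δ (p.cls b)) < p.d (jointType (C b) x)}

/-- The probability that the recursive construction produces the codebook `C`: by the chain
rule, the product of the conditional probabilities of the successive equiprobable draws. -/
def codebookProb (p : Params V X m n k) (C : Codebook V X n k) : ℝ :=
  open Classical in
  ∏ a, if C a ∈ p.drawSet C a then ((#(p.drawSet C a) : ℝ))⁻¹ else 0

/-- `ζ = N_k (n + 1) ^ (|X| ^ 2 + |X|)`, with `N_k` the number of source types. -/
def zeta (_p : Params V X m n k) : ℝ :=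
  Fintype.card (SeqType k V) * ((n : ℝ) + 1) ^ (Fintype.card X ^ 2 + Fintype.card X)

/-- The condition on the distance, the thresholds and the slack `δ`. The inner sum over the
sequences `x` of type `Q_c` with `d(x, x̃_j) ≤ Δ_j` depends on `x̃_j` only through its type. -/
def Cond (p : Params V X m n k) (δ : ℝ) : Prop :=
  open Classical in
  ∀ (c : Fin m) (xt : SeqType k V → (Fin n → X)), (∀ j, xt j ∈ typeClass (p.Q (p.μ j))) →
    ∑ j, ∑ x ∈ typeClass (p.Q c) with p.d (jointType x (xt j)) ≤ p.Δ j,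
        (#(typeClass j) : ℝ)
      ≤ p.zeta * #(typeClass (p.Q c)) * Real.exp (-(n * δ))

/-- `dec` decodes with the metric `q`: for every codebook and channel output, the decoded
message maximizes the metric (ties are broken arbitrarily). -/
def IsDecoder {Y : Type*} (p : Params V X m n k) (q : SeqType k V → (X × Y → ℝ) → EReal)
    (dec : Codebook V X n k → (Fin n → Y) → (Fin k → V)) : Prop :=
  ∀ C y v, q (typeOf v) (jointType (p.codeword C v) y)
    ≤ q (typeOf (dec C y)) (jointType (p.codeword C (dec C y)) y)

/-- The error probability averaged over the messages, the channel and the code ensemble. -/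
def avgError {Y : Type*} [Fintype Y] (p : Params V X m n k) (PV : V → ℝ) (W : X → Y → ℝ)
    (dec : Codebook V X n k → (Fin n → Y) → (Fin k → V)) : ℝ :=
  open Classical in
  ∑ C : Codebook V X n k, p.codebookProb C *
    ∑ v : Fin k → V, (∏ s, PV (v s)) *
      ∑ y : Fin n → Y, (∏ s, W (p.codeword C v s) (y s)) * if dec C y ≠ v then 1 else 0

/-- The transmission rate `t = k / n`. -/
def rate (_p : Params V X m n k) : ℝ := (k : ℝ) / n

/-- `R_i = t H(P_i)`. -/
def R (p : Params V X m n k) (i : SeqType k V) : ℝ := p.rate * entropy i.1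

/-- The set `Γ_{ij}` of joint types of `(X, X̄, Y)`; the coordinates of `X × X × Y` are
`(x, x̄, y)`. -/
def Γ {Y : Type*} [Fintype Y] (p : Params V X m n k) (q : SeqType k V → (X × Y → ℝ) → EReal)
    (i j : SeqType k V) : Set (SeqType n (X × X × Y)) :=
  {P | margin (fun z => z.1) P.1 = (p.Q (p.μ i)).1 ∧
    margin (fun z => z.2.1) P.1 = (p.Q (p.μ j)).1 ∧
    max (p.Δ i) (p.Δ j) ≤ p.d (margin (fun z => (z.1, z.2.1)) P.1) ∧
    q i (margin (fun z => (z.1, z.2.2)) P.1) ≤ q j (margin (fun z => (z.2.1, z.2.2)) P.1)}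

/-- The exponent `E_rgv^{(ij)}(PV, W)`. The minimum over an empty set is `∞`. -/
def exponent {Y : Type*} [Fintype Y] (p : Params V X m n k)
    (q : SeqType k V → (X × Y → ℝ) → EReal) (PV : V → ℝ) (W : X → Y → ℝ)
    (i j : SeqType k V) : EReal :=
  (p.rate : EReal) * sourceExponent (p.R i / p.rate) PV +
    ⨅ P ∈ p.Γ q i j,
      (relEntropy (margin (fun z => (z.1, z.2.2)) P.1)
          (fun z => (p.Q (p.μ i)).1 z.1 * W z.1 z.2) +
        (max (mutualInfo (margin (fun z => (z.2.1, (z.1, z.2.2))) P.1) - p.R j) 0 : ℝ))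

/-- The sum over all `i, j` of `exp (-n E_rgv^{(ij)})`. -/
def bound {Y : Type*} [Fintype Y] (p : Params V X m n k)
    (q : SeqType k V → (X × Y → ℝ) → EReal) (PV : V → ℝ) (W : X → Y → ℝ) : ENNReal :=
  ∑ i, ∑ j, EReal.exp (-((n : EReal) * p.exponent q PV W i j))

end Params

/-- Exponential inequality at speed `n`: `limsup (1 / n) log (f / g) ≤ 0`. -/
def ExpLE (n : ℕ → ℕ) (f g : ℕ → ENNReal) : Prop :=
  limsup (fun l => ENNReal.log (f l / g l) / (n l : EReal)) atTop ≤ 0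

end RGV

end

/-! The theorem is a union bound in which only pairs of codewords matter. Since the thresholds
decrease along the order, the set forbidden to a new codeword is a union of balls around the earlier
codewords, the ball around one of class `j` having radius `Δ j`. `Cond` bounds the total size of
these balls by `ζ exp (-nδ)` times the type class, and `ζ` is polynomial in `n`, so eventually at
least half of the type class remains. No draw set is then empty, and every draw hits a given
sequence with conditional probability at most twice that of a uniform draw from the type class.
Hence a pair of codewords is, up to a factor 4, dominated by an independent uniform pair
(`sum_codebookProb_codeword_pair_le`).

An error produces a competing message whose codeword forms with the sent codeword and the output a
joint type in `Γ` (`exists_competitor`); the distance constraint there comes from the construction.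
With the sent codeword and the output fixed, the probability of a competitor of class `j` and joint
type `P` is bounded both trivially and by a union bound (`sum_codebookProb_competitor_le`). The
minimum of the two gives the positive part of `I - R_j`.

Method-of-types estimates turn each term into `exp (-nE)` times a polynomial (`competitorBound_le`,
`exp_mul_exp_mul_exp_le`). There are polynomially many joint types, and polynomial factors vanish at
exponential scale. -/

namespace RGV

/-! ### Method of types: probabilities and sizes of type classes and shells -/

section Types

variable {α β : Type*} {n : ℕ}

theorem mem_typeClass [Fintype α] {Q : SeqType n α} {x : Fin n → α} :
    x ∈ typeClass Q ↔ empType x = Q.1 := by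
  simp [typeClass, typeOf, Subtype.ext_iff]

theorem empType_nonneg (x : Fin n → α) (a : α) : 0 ≤ empType x a := by
  unfold empType; positivity

theorem empType_pos (x : Fin n → α) (i : Fin n) : 0 < empType x (x i) := by
  classical
  have hn : 0 < n := i.pos
  unfold empType
  have : 0 < #{j | x j = x i} := card_pos.2 ⟨i, by simp⟩
  have h2 : (0 : ℝ) < n := by exact_mod_cast hn
  convert div_pos (Nat.cast_pos.2 this) h2

theorem sum_comp_eq_empType [Fintype α] (hn : 0 < n) (x : Fin n → α) (f : α → ℝ) :
    ∑ i, f (x i) = n * ∑ a, empType x a * f a := by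
  classical
  have hn' : (n : ℝ) ≠ 0 := by exact_mod_cast hn.ne'
  rw [← Finset.sum_fiberwise univ x, Finset.mul_sum]
  refine sum_congr rfl fun a _ => ?_
  rw [sum_congr rfl (g := fun _ => f a) (by intro i hi; rw [(mem_filter.1 hi).2]), sum_const,
    nsmul_eq_mul, empType]
  field_simp

theorem sum_empType [Fintype α] (hn : 0 < n) (x : Fin n → α) : ∑ a, empType x a = 1 := by
  have h := sum_comp_eq_empType hn x (fun _ => 1)
  have hn' : (n : ℝ) ≠ 0 := by exact_mod_cast hn.ne'
  simp only [sum_const, card_univ, Fintype.card_fin, nsmul_eq_mul, mul_one] at h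
  exact (mul_left_cancel₀ hn' (by rw [← h, mul_one])).symm

theorem prod_comp_eq_exp [Fintype α] (hn : 0 < n) (x : Fin n → α) (g : α → ℝ)
    (hg : ∀ i, 0 < g (x i)) :
    ∏ i, g (x i) = Real.exp (n * ∑ a, empType x a * Real.log (g a)) := by
  rw [← sum_comp_eq_empType hn x fun a => Real.log (g a), Real.exp_sum]
  exact prod_congr rfl fun i _ => (Real.exp_log (hg i)).symm

theorem margin_empType [Fintype α] (f : α → β) (x : Fin n → α) :
    margin f (empType x) = empType (fun i => f (x i)) := by
  classical
  ext b
  simp only [margin, empType]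
  rw [← Finset.sum_div]
  congr 1
  rw [← Nat.cast_sum]
  congr 1
  have := Finset.card_eq_sum_card_fiberwise (f := x) (s := {i | f (x i) = b})
    (t := {a | f a = b}) (by intro i hi; simpa using hi)
  convert this.symm using 2 with a ha
  · simp only [mem_filter, mem_univ, true_and] at ha
    congr 1; ext i; simp only [mem_filter, mem_univ, true_and]
    constructor
    · rintro rfl; exact ⟨ha, rfl⟩
    · exact fun h => h.2

theorem sum_prod_le [Fintype α] (s : Finset (Fin n → α)) {g : α → ℝ} (hg : ∀ a, 0 ≤ g a) :
    ∑ x ∈ s, ∏ i, g (x i) ≤ (∑ a, g a) ^ n := by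
  classical
  rw [Fintype.sum_pow]
  exact sum_le_univ_sum_of_nonneg fun x => prod_nonneg fun i _ => hg _

/-- The probability of a type class under a memoryless source. -/
theorem sum_typeClass_prod_le [Fintype α] (hn : 0 < n) (P : SeqType n α) {g : α → ℝ}
    (hg : ∀ a, 0 ≤ g a) :
    ENNReal.ofReal (∑ x ∈ typeClass P, ∏ i, g (x i)) ≤
      EReal.exp (-((n : EReal) * relEntropy P.1 g)) := by
  classical
  obtain ⟨P, x₀, rfl⟩ := P
  unfold relEntropy
  split_ifs with h
  · have hpos : ∀ x ∈ typeClass (⟨empType x₀, x₀, rfl⟩ : SeqType n α), ∀ i, 0 < g (x i) := by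
      intro x hx i
      refine lt_of_le_of_ne (hg _) fun h0 => ?_
      have := h _ h0.symm
      rw [← mem_typeClass.1 hx] at this
      exact (empType_pos x i).ne' this
    set S := ∑ a, empType x₀ a * Real.log (empType x₀ a / g a) with hS
    -- Change of measure: on the type class the `g`-probability is a constant times the probability
    -- under the type itself, whose total mass is at most 1.
    have key : ∀ x ∈ typeClass (⟨empType x₀, x₀, rfl⟩ : SeqType n α),
        ∏ i, g (x i) = Real.exp (-(n * S)) * ∏ i, empType x₀ (x i) := by
      intro x hx
      have hx' : empType x = empType x₀ := mem_typeClass.1 hx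
      rw [prod_comp_eq_exp hn x g (hpos x hx),
        prod_comp_eq_exp hn x (empType x₀) (fun i => hx' ▸ empType_pos x i), ← Real.exp_add, hx']
      congr 1
      rw [hS, ← mul_neg, ← mul_add, ← sum_neg_distrib, ← sum_add_distrib]
      congr 1
      refine sum_congr rfl fun a _ => ?_
      by_cases ha : empType x₀ a = 0
      · simp [ha]
      · rw [Real.log_div ha (fun h0 => ha (h a h0))]; ring
    rw [sum_congr rfl key, ← mul_sum]
    have h1 : ∑ x ∈ typeClass (⟨empType x₀, x₀, rfl⟩ : SeqType n α), ∏ i, empType x₀ (x i) ≤ 1 := by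
      have := sum_prod_le (n := n) (typeClass (⟨empType x₀, x₀, rfl⟩ : SeqType n α))
        (empType_nonneg x₀)
      rwa [sum_empType hn, one_pow] at this
    have : (-((n : EReal) * (S : EReal))) = ((-(n * S) : ℝ) : EReal) := by
      push_cast; rfl
    rw [this, EReal.exp_coe]
    exact ENNReal.ofReal_le_ofReal (mul_le_of_le_one_right (Real.exp_pos _).le h1)
  -- Infinite divergence: some letter of zero `g`-mass occurs in every sequence of the class, so the
  -- probability is 0.
  · push Not at h
    obtain ⟨a, ha, ha'⟩ := h
    rw [sum_eq_zero, ENNReal.ofReal_zero]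
    · exact zero_le
    · intro x hx
      have hx' : empType x = empType x₀ := mem_typeClass.1 hx
      have : ∃ i, x i = a := by
        by_contra! hne
        apply ha'
        change empType x₀ a = 0
        rw [← hx']
        simp [empType, hne]
      obtain ⟨i, hi⟩ := this
      exact prod_eq_zero (mem_univ i) (by rw [hi, ha])

/-- Under the product law of their own type all these sequences have the same probability `exp
(-nH)`, and the total is at most 1. -/
theorem card_typeClass_le [Fintype α] (hn : 0 < n) (P : SeqType n α) :
    (#(typeClass P) : ℝ) ≤ Real.exp (n * entropy P.1) := by
  obtain ⟨P, x₀, rfl⟩ := P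
  have key : ∀ x ∈ typeClass (⟨empType x₀, x₀, rfl⟩ : SeqType n α),
      Real.exp (-(n * entropy (empType x₀))) = ∏ i, empType x₀ (x i) := by
    intro x hx
    have hx' : empType x = empType x₀ := mem_typeClass.1 hx
    rw [prod_comp_eq_exp hn x (empType x₀) (fun i => hx' ▸ empType_pos x i), hx']
    simp only [entropy, Real.negMulLog, neg_mul, sum_neg_distrib, mul_neg, neg_neg]
  have h1 := sum_prod_le (n := n) (typeClass (⟨empType x₀, x₀, rfl⟩ : SeqType n α))
    (empType_nonneg x₀)
  rw [sum_empType hn, one_pow, ← sum_congr rfl key, sum_const, nsmul_eq_mul, Real.exp_neg,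
    ← div_eq_mul_inv, div_le_one (Real.exp_pos _)] at h1
  exact h1

/-- The number of sequences having a given joint type with a given sequence. -/
theorem card_jointType_le [Fintype α] [Fintype β] [DecidableEq (α × β → ℝ)] (hn : 0 < n)
    (P : α × β → ℝ) (y : Fin n → β) :
    (#{x : Fin n → α | jointType x y = P} : ℝ) ≤
      Real.exp (-(n * ∑ z, P z * Real.log (P z / margin Prod.snd P z.2))) := by
  classical
  by_cases hex : ∃ x : Fin n → α, jointType x y = P
  swap
  · push Not at hex
    simp only [hex, filter_false, card_empty, Nat.cast_zero]
    exact (Real.exp_pos _).le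
  obtain ⟨x₀, hx₀⟩ := hex
  have hm : margin Prod.snd P = empType y := by
    rw [← hx₀, jointType, margin_empType]
  have hP0 : ∀ z, 0 ≤ P z := fun z => hx₀ ▸ empType_nonneg _ z
  -- Under the conditional law of `P` given `y` every member of the shell has the same probability;
  -- the exponent is `-n` times the negative conditional entropy.
  have key : ∀ x ∈ ({x : Fin n → α | jointType x y = P} : Finset _),
      Real.exp (n * ∑ z, P z * Real.log (P z / margin Prod.snd P z.2)) =
        ∏ i, (P (x i, y i) / empType y (y i)) := by
    intro x hx
    have hx' : jointType x y = P := (mem_filter.1 hx).2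
    have := prod_comp_eq_exp hn (fun i => (x i, y i)) (fun z => P z / empType y z.2)
      (fun i => div_pos (by
        rw [← hx']; exact empType_pos (fun i => (x i, y i)) i) (empType_pos y i))
    rw [this, hm]
    rw [show empType (fun i => (x i, y i)) = P from hx']
  have h1 : ∑ x : Fin n → α, ∏ i, (P (x i, y i) / empType y (y i)) ≤ 1 := by
    have := Finset.prod_univ_sum (fun _ : Fin n => (univ : Finset α))
      (fun i a => P (a, y i) / empType y (y i))
    rw [Fintype.piFinset_univ] at this
    rw [← this]
    refine (prod_eq_one fun i _ => ?_).le
    rw [← sum_div, div_eq_one_iff_eq (empType_pos y i).ne', ← hm, margin]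
    refine sum_bij (fun a _ => (a, y i)) (by simp) (by simp) ?_ (by simp)
    rintro ⟨a, b⟩ h
    exact ⟨a, mem_univ _, by simpa using (by simpa using h : b = y i).symm⟩
  have h2 := (sum_le_univ_sum_of_nonneg (s := ({x : Fin n → α | jointType x y = P} : Finset _))
    (fun x => prod_nonneg fun i _ => div_nonneg (hP0 (x i, y i)) (empType_nonneg y (y i)))).trans h1
  rw [← sum_congr rfl key, sum_const, nsmul_eq_mul] at h2
  rw [Real.exp_neg, ← one_div, le_div_iff₀ (Real.exp_pos _)]
  exact h2

/-- The Stirling sequence decreases from its value `e / √2` at 1. The factor `k + 1`, cruder than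
`√k`, also covers `k = 0`. -/
theorem factorial_le (k : ℕ) :
    (k.factorial : ℝ) ≤ Real.exp 1 * (k + 1) * (k / Real.exp 1) ^ k := by
  rcases k with _ | k
  · simp
  · have h := Stirling.stirlingSeq'_antitone (Nat.zero_le k)
    simp only [Function.comp, Nat.succ_eq_add_one, zero_add] at h
    rw [Stirling.stirlingSeq_one, Stirling.stirlingSeq] at h
    have hpos : 0 < √(2 * ((k + 1 : ℕ) : ℝ)) * (((k + 1 : ℕ) : ℝ) / Real.exp 1) ^ (k + 1) := by
      positivity
    rw [div_le_iff₀ hpos] at h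
    refine h.trans ?_
    rw [← mul_assoc]
    refine mul_le_mul_of_nonneg_right ?_ (by positivity)
    rw [div_mul_eq_mul_div, div_le_iff₀ (by positivity), mul_assoc]
    refine mul_le_mul_of_nonneg_left ?_ (by positivity)
    rw [Real.sqrt_mul (by norm_num), mul_comm]
    refine mul_le_mul_of_nonneg_right ?_ (by positivity)
    rw [Real.sqrt_le_left (by positivity)]
    push_cast
    nlinarith [(Nat.cast_nonneg k : (0 : ℝ) ≤ k)]

theorem pow_div_exp_le_factorial (n : ℕ) : ((n : ℝ) / Real.exp 1) ^ n ≤ n.factorial := by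
  rcases Nat.eq_zero_or_pos n with rfl | hn
  · simp
  refine le_trans ?_ (Stirling.le_factorial_stirling n)
  refine le_mul_of_one_le_left (by positivity) ?_
  rw [Real.one_le_sqrt]
  have : (1 : ℝ) ≤ n := by exact_mod_cast hn
  nlinarith [Real.pi_gt_three]

/-- Permutations of the positions map `x` into its type class. Each nonempty fibre is a coset of the
stabilizer of `x`, which has `∏ (count of a)!` elements. -/
theorem factorial_le_card_typeClass_mul [Fintype α] [DecidableEq α] (x : Fin n → α) :
    n.factorial ≤ (∏ a, (#{i | x i = a}).factorial) * #(typeClass (typeOf x)) := by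
  classical
  have h := Finset.card_le_mul_card_image_of_maps_to (s := (univ : Finset (Equiv.Perm (Fin n))))
    (t := typeClass (typeOf x)) (f := fun σ : Equiv.Perm (Fin n) => x ∘ σ) ?_
    (∏ a, (#{i | x i = a}).factorial) ?_
  · rwa [card_univ, Fintype.card_perm, Fintype.card_fin] at h
  · intro σ _
    rw [mem_typeClass]
    ext a
    simp only [typeOf, empType, Function.comp]
    congr 2
    exact card_bij (fun i _ => σ i) (by simp) (by simp) (fun i hi => ⟨σ.symm i, by simpa using hi⟩)
  · intro y _
    by_cases hy : ∃ σ₀ : Equiv.Perm (Fin n), x ∘ σ₀ = y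
    · obtain ⟨σ₀, rfl⟩ := hy
      have hst := DomMulAct.stabilizer_card x
      simp only [Fintype.card_subtype] at hst
      rw [← hst]
      refine card_le_card_of_injOn (fun σ => σ * σ₀⁻¹) ?_ ?_
      · intro σ hσ
        simp only [coe_filter, mem_univ, true_and, Set.mem_ofPred_eq] at hσ ⊢
        ext i
        have := congrFun hσ (σ₀⁻¹ i)
        simpa using this
      · intro σ _ τ _ h
        exact mul_right_cancel h
    · push Not at hy
      simp [hy]

/-- The class has at least the multinomial size. In Stirling's bounds the powers of `e` cancel
because the letter counts `κ` add up to `n`, leaving `exp (nH)` and one factor `e (n + 1)` per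
letter. -/
theorem exp_entropy_le [Fintype α] (hn : 0 < n) (P : SeqType n α) :
    Real.exp (n * entropy P.1) ≤
      (Real.exp 1 * (n + 1)) ^ Fintype.card α * #(typeClass P) := by
  classical
  obtain ⟨P, x, rfl⟩ := P
  set κ : α → ℕ := fun a => #{i | x i = a} with hκ
  have hκn : ∀ a, (κ a : ℝ) = n * empType x a := by
    intro a
    have hn' : (n : ℝ) ≠ 0 := by exact_mod_cast hn.ne'
    simp only [hκ, empType]; field_simp
  have hsum : ∑ a, κ a = n := by
    have := (card_eq_sum_card_fiberwise (f := x) (s := univ) (t := univ) (by simp)).symm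
    rwa [card_univ, Fintype.card_fin] at this
  have h1 : (n.factorial : ℝ) ≤ (∏ a, ((κ a).factorial : ℝ)) * #(typeClass (typeOf x)) := by
    exact_mod_cast factorial_le_card_typeClass_mul x
  have h2 : ∏ a, ((κ a).factorial : ℝ) ≤
      (Real.exp 1 * (n + 1)) ^ Fintype.card α * ∏ a, ((κ a : ℝ) / Real.exp 1) ^ κ a := by
    rw [← card_univ, ← prod_const, ← prod_mul_distrib]
    refine prod_le_prod (fun a _ => by positivity) fun a _ => (factorial_le _).trans ?_
    have : κ a ≤ n := hsum ▸ single_le_sum (f := κ) (fun _ _ => Nat.zero_le _) (mem_univ a)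
    have : (κ a : ℝ) ≤ n := by exact_mod_cast this
    gcongr
  have hpos : 0 < ∏ a, ((κ a : ℝ) / Real.exp 1) ^ κ a := by
    refine prod_pos fun a _ => ?_
    rcases Nat.eq_zero_or_pos (κ a) with h | h
    · simp [h]
    · positivity
  have h3 : Real.exp (n * entropy (empType x)) * ∏ a, ((κ a : ℝ) / Real.exp 1) ^ κ a =
      ((n : ℝ) / Real.exp 1) ^ n := by
    have hn' : (0 : ℝ) < n := by exact_mod_cast hn
    have e1 : ∏ a, ((κ a : ℝ) / Real.exp 1) ^ κ a =
        Real.exp (∑ a, (κ a : ℝ) * (Real.log (κ a) - 1)) := by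
      rw [Real.exp_sum]
      refine prod_congr rfl fun a _ => ?_
      rcases Nat.eq_zero_or_pos (κ a) with h | h
      · simp [h]
      · have : (0 : ℝ) < κ a := by exact_mod_cast h
        rw [mul_comm, Real.exp_mul, Real.exp_sub, Real.exp_log this, Real.rpow_natCast]
    have e2 : ((n : ℝ) / Real.exp 1) ^ n = Real.exp (n * (Real.log n - 1)) := by
      rw [mul_comm, Real.exp_mul, Real.exp_sub, Real.exp_log hn', Real.rpow_natCast]
    rw [e1, e2, ← Real.exp_add]
    congr 1
    have e3 : ∀ a, (κ a : ℝ) * (Real.log (κ a) - 1) =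
        n * (empType x a * Real.log (empType x a)) + n * empType x a * (Real.log n - 1) := by
      intro a
      rw [hκn]
      rcases (empType_nonneg x a).eq_or_lt with h | h
      · simp [← h]
      · rw [Real.log_mul hn'.ne' h.ne']; ring
    rw [sum_congr rfl fun a _ => e3 a, sum_add_distrib, ← sum_mul, ← mul_sum, ← mul_sum,
      sum_empType hn]
    simp only [entropy, Real.negMulLog, neg_mul, sum_neg_distrib]
    ring
  have h4 : Real.exp (n * entropy (empType x)) * ∏ a, ((κ a : ℝ) / Real.exp 1) ^ κ a ≤
      ((Real.exp 1 * (n + 1)) ^ Fintype.card α * #(typeClass (typeOf x))) *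
        ∏ a, ((κ a : ℝ) / Real.exp 1) ^ κ a := by
    rw [h3]
    refine (pow_div_exp_le_factorial n).trans (h1.trans ?_)
    refine (mul_le_mul_of_nonneg_right h2 (Nat.cast_nonneg _)).trans (le_of_eq ?_)
    ring
  exact le_of_mul_le_mul_right h4 hpos

/-- A type is determined by its letter counts, each between 0 and `n`. -/
theorem card_seqType_le [Fintype α] : Fintype.card (SeqType n α) ≤ (n + 1) ^ Fintype.card α := by
  classical
  rw [← Fintype.card_fin (n + 1), ← Fintype.card_fun]
  refine Fintype.card_le_of_injective
    (fun P a => ⟨#{i | P.2.choose i = a}, Nat.lt_succ_of_le ((card_le_univ _).trans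
      (by simp))⟩) fun P P' h => Subtype.ext ?_
  rw [← P.2.choose_spec, ← P'.2.choose_spec]
  ext a
  have := congrArg Fin.val (congrFun h a)
  simp only at this
  simp only [empType]
  congr 2

end Types

/-! ### Sequential draws from history-dependent sets -/

section SequentialDraws

variable {N : ℕ} {S : Type*}

/-- The conditional probability of the `a`-th draw when each draw is equiprobable on a set that
depends on the earlier draws. -/
noncomputable def drawProb (D : (Fin N → S) → Fin N → Finset S) (C : Fin N → S) (a : Fin N) : ℝ :=
  open Classical in if C a ∈ D C a then ((#(D C a) : ℝ))⁻¹ else 0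

/-- The weight of `C` when the first `r` draws follow the recursive construction and the others
are independent and equiprobable. -/
noncomputable def drawWeight [Fintype S] (D : (Fin N → S) → Fin N → Finset S) (r : ℕ)
    (C : Fin N → S) : ℝ :=
  ∏ a : Fin N, if a.val < r then drawProb D C a else (Fintype.card S : ℝ)⁻¹

theorem drawProb_nonneg (D : (Fin N → S) → Fin N → Finset S) (C : Fin N → S) (a : Fin N) :
    0 ≤ drawProb D C a := by
  unfold drawProb; split_ifs <;> positivity

theorem drawWeight_nonneg [Fintype S] (D : (Fin N → S) → Fin N → Finset S) (r : ℕ)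
    (C : Fin N → S) : 0 ≤ drawWeight D r C :=
  prod_nonneg fun a _ => by
    split_ifs
    · exact drawProb_nonneg D C a
    · positivity

theorem mem_of_drawWeight_ne_zero [Fintype S] {D : (Fin N → S) → Fin N → Finset S} {r : ℕ}
    {C : Fin N → S} (h : drawWeight D r C ≠ 0) (a : Fin N) (ha : a.val < r) : C a ∈ D C a := by
  by_contra hn
  exact h (prod_eq_zero (mem_univ a) (by simp [ha, drawProb, hn]))

/-- Exchanging the coordinate `C a` with an extra symbol `s` is an involution. This is how a single
coordinate is averaged out. -/
theorem card_mul_sum_eq_sum_update [Fintype S] (F : (Fin N → S) → ℝ) (a : Fin N) :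
    (Fintype.card S : ℝ) * ∑ C, F C = ∑ C, ∑ s, F (Function.update C a s) := by
  have hinv : Function.Involutive
      (fun z : (Fin N → S) × S => (Function.update z.1 a z.2, z.1 a)) := by
    rintro ⟨C, s⟩; simp
  have := Equiv.sum_comp hinv.toPerm (fun z : (Fin N → S) × S => F z.1)
  rw [Fintype.sum_prod_type, Fintype.sum_prod_type] at this
  simp only [Function.Involutive.coe_toPerm, sum_const, card_univ, nsmul_eq_mul] at this
  rw [this, mul_sum]

variable [Fintype S] {D : (Fin N → S) → Fin N → Finset S}

/-- One step of a hybrid argument. Earlier factors do not see coordinate `a`, and later ones are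
constants, so averaging coordinate `a` out replaces `g (C a)` by its mean over the draw set. -/
theorem sum_drawWeight_succ_mul (hD : ∀ C C' a, (∀ b < a, C b = C' b) → D C a = D C' a)
    (a : Fin N) (h : (Fin N → S) → ℝ) (hh : ∀ C s, h (Function.update C a s) = h C) (g : S → ℝ) :
    ∑ C, drawWeight D (a + 1) C * (h C * g (C a)) =
      ∑ C, drawWeight D a C * (h C * ((#(D C a) : ℝ)⁻¹ * ∑ s ∈ D C a, g s)) := by
  classical
  cases isEmpty_or_nonempty S with
  | inl hS =>
    have : IsEmpty (Fin N → S) := ⟨fun C => hS.false (C a)⟩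
    simp
  | inr hS =>
  have hcard : (Fintype.card S : ℝ) ≠ 0 := by exact_mod_cast Fintype.card_ne_zero
  set G : (Fin N → S) → ℝ := fun C =>
    ∏ b ∈ univ.erase a, if b.val < a.val then drawProb D C b else (Fintype.card S : ℝ)⁻¹ with hG
  have hDu : ∀ C s b, b.val ≤ a.val → D (Function.update C a s) b = D C b := by
    intro C s b hb
    refine hD _ _ _ fun c hc => ?_
    rw [Function.update_of_ne]
    rintro rfl
    exact absurd hb (not_le.2 hc)
  have hGu : ∀ C s, G (Function.update C a s) = G C := by
    intro C s
    refine prod_congr rfl fun b hb => ?_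
    split_ifs with hlt
    · rw [drawProb, drawProb, hDu C s b hlt.le, Function.update_of_ne (ne_of_mem_erase hb)]
    · rfl
  have h1 : ∀ C, drawWeight D (a + 1) C = G C * drawProb D C a := by
    intro C
    rw [drawWeight, ← mul_prod_erase _ _ (mem_univ a), mul_comm]
    congr 1
    · refine prod_congr rfl fun b hb => ?_
      have : b.val ≠ a.val := fun h => ne_of_mem_erase hb (Fin.ext h)
      simp only [show b.val < a.val + 1 ↔ b.val < a.val by omega]
    · simp
  have h2 : ∀ C, drawWeight D a C = G C * (Fintype.card S : ℝ)⁻¹ := by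
    intro C
    rw [drawWeight, ← mul_prod_erase _ _ (mem_univ a), mul_comm]
    congr 1
    simp
  apply mul_left_cancel₀ hcard
  rw [card_mul_sum_eq_sum_update _ a, mul_sum]
  refine sum_congr rfl fun C _ => ?_
  simp only [h1, h2, hGu, hh, drawProb, Function.update_self]
  simp only [hDu C _ a le_rfl]
  rw [← sum_filter_add_sum_filter_not univ (fun s => s ∈ D C a)]
  rw [sum_eq_zero (s := univ.filter fun s => s ∉ D C a)
    (fun s hs => by simp [(mem_filter.1 hs).2])]
  rw [add_zero, filter_mem_eq_inter, univ_inter, mul_sum, mul_sum, mul_sum, mul_sum]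
  refine sum_congr rfl fun s hs => ?_
  rw [if_pos hs]
  field_simp

/-- If the sets stay nonempty along every possible history, the draws after the `r`-th do not
affect the distribution of the first `r`. -/
theorem sum_drawWeight_mul_eq (hD : ∀ C C' a, (∀ b < a, C b = C' b) → D C a = D C' a)
    (hne : ∀ C a, (∀ b < a, C b ∈ D C b) → (D C a).Nonempty) {r : ℕ}
    (h : (Fin N → S) → ℝ) (hh : ∀ C a s, r ≤ a.val → h (Function.update C a s) = h C)
    {r' : ℕ} (hr : r ≤ r') (hN : r' ≤ N) :
    ∑ C, drawWeight D r' C * h C = ∑ C, drawWeight D r C * h C := by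
  induction r', hr using Nat.le_induction with
  | base => rfl
  | succ t ht ih =>
    rw [← ih (by omega)]
    have := sum_drawWeight_succ_mul hD ⟨t, hN⟩ h (fun C s => hh C _ s ht) (fun _ => 1)
    simp only [mul_one] at this
    rw [this]
    refine sum_congr rfl fun C _ => ?_
    -- Only histories of nonzero weight count. Their draw set is nonempty, so the mean of 1 over it
    -- is 1; over an empty set it would be 0 and mass would be lost.
    by_cases h0 : drawWeight D t C = 0
    · simp [h0]
    · have := hne C ⟨t, hN⟩ fun b hb => mem_of_drawWeight_ne_zero h0 b hb
      have : (#(D C ⟨t, hN⟩) : ℝ) ≠ 0 := by exact_mod_cast this.card_pos.ne'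
      simp [this]

theorem sum_drawWeight_eq_one [Nonempty S]
    (hD : ∀ C C' a, (∀ b < a, C b = C' b) → D C a = D C' a)
    (hne : ∀ C a, (∀ b < a, C b ∈ D C b) → (D C a).Nonempty) {r : ℕ} (hr : r ≤ N) :
    ∑ C, drawWeight D r C = 1 := by
  have h := sum_drawWeight_mul_eq hD hne (fun _ => 1) (fun _ _ _ _ => rfl) (Nat.zero_le r) hr
  simp only [mul_one] at h
  rw [h]
  simp [drawWeight]

theorem sum_drawWeight_succ_mul_indicator_le [DecidableEq S]
    (hD : ∀ C C' a, (∀ b < a, C b = C' b) → D C a = D C' a)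
    {κ : ℝ} (a : Fin N)
    (hc : ∀ C, (∀ b < a, C b ∈ D C b) → ((#(D C a) : ℝ))⁻¹ ≤ κ)
    (h : (Fin N → S) → ℝ) (h0 : ∀ C, 0 ≤ h C)
    (hh : ∀ C s, h (Function.update C a s) = h C) (s : S) :
    ∑ C, drawWeight D (a + 1) C * (h C * if C a = s then 1 else 0) ≤
      κ * ∑ C, drawWeight D a C * h C := by
  rw [sum_drawWeight_succ_mul hD a h hh (fun s' => if s' = s then 1 else 0), mul_sum]
  refine sum_le_sum fun C _ => ?_
  by_cases hw : drawWeight D a C = 0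
  · simp [hw]
  have h1 := hc C fun b hb => mem_of_drawWeight_ne_zero hw b hb
  have h2 : ∑ s' ∈ D C a, (if s' = s then (1 : ℝ) else 0) ≤ 1 := by
    rw [sum_ite_eq']; split_ifs <;> norm_num
  have h3 : (#(D C a) : ℝ)⁻¹ * ∑ s' ∈ D C a, (if s' = s then (1 : ℝ) else 0) ≤ κ :=
    (mul_le_of_le_one_right (by positivity) h2).trans h1
  calc drawWeight D a C * (h C * _) ≤ drawWeight D a C * (h C * κ) := by
        have := h0 C; have := drawWeight_nonneg D a C; gcongr
    _ = _ := by ring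

theorem sum_drawWeight_indicator_le [Nonempty S] [DecidableEq S]
    (hD : ∀ C C' a, (∀ b < a, C b = C' b) → D C a = D C' a)
    (hne : ∀ C a, (∀ b < a, C b ∈ D C b) → (D C a).Nonempty)
    {κ : Fin N → ℝ}
    (hc : ∀ C a, (∀ b < a, C b ∈ D C b) → ((#(D C a) : ℝ))⁻¹ ≤ κ a) (a : Fin N) (s : S) :
    ∑ C, drawWeight D N C * (if C a = s then 1 else 0) ≤ κ a := by
  rw [sum_drawWeight_mul_eq hD hne (r := a + 1) _ _ a.2 le_rfl]
  · have := sum_drawWeight_succ_mul_indicator_le hD a (fun C => hc C a) (fun _ => 1)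
      (fun _ => zero_le_one) (fun _ _ => rfl) s
    simpa only [one_mul, mul_one, sum_drawWeight_eq_one hD hne a.2.le] using this
  · intro C b s' hb
    rw [Function.update_of_ne]
    rintro rfl
    omega

/-- The later draw `b` is averaged out first: the indicator for `a` belongs to its past, and the
bound `κ b` is uniform over reachable histories. -/
theorem sum_drawWeight_pair_le_of_lt [Nonempty S] [DecidableEq S]
    (hD : ∀ C C' a, (∀ b < a, C b = C' b) → D C a = D C' a)
    (hne : ∀ C a, (∀ b < a, C b ∈ D C b) → (D C a).Nonempty)
    {κ : Fin N → ℝ} (hκ : ∀ a, 0 ≤ κ a)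
    (hc : ∀ C a, (∀ b < a, C b ∈ D C b) → ((#(D C a) : ℝ))⁻¹ ≤ κ a) {a b : Fin N} (hab : a < b)
    (s s' : S) :
    ∑ C, drawWeight D N C * ((if C a = s then 1 else 0) * (if C b = s' then 1 else 0)) ≤
      κ a * κ b := by
  have hh : ∀ (C : Fin N → S) c t, b.val ≤ c.val →
      (if Function.update C c t a = s then (1 : ℝ) else 0) = if C a = s then 1 else 0 := by
    intro C c t hc
    rw [Function.update_of_ne]
    rintro rfl
    exact absurd hc (not_le.2 hab)
  rw [sum_drawWeight_mul_eq hD hne (r := b + 1) _ _ b.2 le_rfl]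
  · refine (sum_drawWeight_succ_mul_indicator_le hD b (fun C => hc C b)
      (fun C => if C a = s then 1 else 0) (fun C => by positivity)
      (fun C t => hh C b t le_rfl) s').trans ?_
    rw [mul_comm, ← sum_drawWeight_mul_eq hD hne (r := b) _ hh b.2.le le_rfl]
    exact mul_le_mul_of_nonneg_right (sum_drawWeight_indicator_le hD hne hc a s) (hκ b)
  · intro C c t hc
    rw [hh C c t (by omega), Function.update_of_ne]
    rintro rfl
    omega

theorem sum_drawWeight_pair_le [Nonempty S] [DecidableEq S]
    (hD : ∀ C C' a, (∀ b < a, C b = C' b) → D C a = D C' a)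
    (hne : ∀ C a, (∀ b < a, C b ∈ D C b) → (D C a).Nonempty)
    {κ : Fin N → ℝ} (hκ : ∀ a, 0 ≤ κ a)
    (hc : ∀ C a, (∀ b < a, C b ∈ D C b) → ((#(D C a) : ℝ))⁻¹ ≤ κ a) {a b : Fin N} (hab : a ≠ b)
    (s s' : S) :
    ∑ C, drawWeight D N C * ((if C a = s then 1 else 0) * (if C b = s' then 1 else 0)) ≤
      κ a * κ b := by
  rcases hab.lt_or_gt with h | h
  · exact sum_drawWeight_pair_le_of_lt hD hne hκ hc h s s'
  · rw [mul_comm (κ a)]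
    refine le_trans (le_of_eq ?_) (sum_drawWeight_pair_le_of_lt hD hne hκ hc h s' s)
    exact sum_congr rfl fun C _ => by rw [mul_comm (ite _ _ _)]

end SequentialDraws

/-! ### The code ensemble: existence and near-independence of pairs -/

theorem typeClass_nonempty {α : Type*} [Fintype α] {n : ℕ} (Q : SeqType n α) :
    (typeClass Q).Nonempty :=
  Q.2.elim fun x hx => ⟨x, mem_typeClass.2 hx⟩

namespace Params

variable {V X : Type*} [Fintype V] [Fintype X] {m n k : ℕ} (p : Params V X m n k)

theorem mem_drawSet {C : Codebook V X n k} {a : Fin (Fintype.card (Fin k → V))}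
    {x : Fin n → X} : x ∈ p.drawSet C a ↔ x ∈ typeClass (p.Q (p.μ (p.cls a))) ∧
      ∀ b, b < a → max (p.Δ (p.cls a)) (p.Δ (p.cls b)) < p.d (jointType (C b) x) := by
  simp [drawSet]

theorem drawSet_congr (C C' : Codebook V X n k) (a : Fin (Fintype.card (Fin k → V)))
    (h : ∀ b < a, C b = C' b) : p.drawSet C a = p.drawSet C' a := by
  ext x
  simp only [mem_drawSet]
  refine and_congr_right fun _ => forall₂_congr fun b hb => by rw [h b hb]

theorem codebookProb_eq_drawWeight (C : Codebook V X n k) :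
    p.codebookProb C = drawWeight p.drawSet (Fintype.card (Fin k → V)) C := by
  refine prod_congr rfl fun a _ => ?_
  rw [if_pos a.2, drawProb]
  congr!

variable {p}

/-- This is the purpose of the ordering: the radius of exclusion depends only on the class of the
earlier codeword, as in `Cond`. -/
theorem max_threshold_eq (hΔ : ∀ i j, p.rank i < p.rank j → p.Δ j ≤ p.Δ i)
    {a b : Fin (Fintype.card (Fin k → V))} (hab : b < a) :
    max (p.Δ (p.cls a)) (p.Δ (p.cls b)) = p.Δ (p.cls b) := by
  rw [max_eq_right]
  rcases (p.enum_mono hab.le).lt_or_eq with h | h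
  · exact hΔ _ _ h
  · exact (congrArg p.Δ (p.rank.injective h)).ge

/-- Along every possible history at least half of the type class is still available. -/
theorem card_typeClass_le_two_mul_card_drawSet
    (hΔ : ∀ i j, p.rank i < p.rank j → p.Δ j ≤ p.Δ i) {δ : ℝ} (hcond : p.Cond δ)
    (hhalf : p.zeta * Real.exp (-(n * δ)) ≤ 1 / 2) (C : Codebook V X n k)
    (a : Fin (Fintype.card (Fin k → V))) (hC : ∀ b < a, C b ∈ p.drawSet C b) :
    (#(typeClass (p.Q (p.μ (p.cls a)))) : ℝ) ≤ 2 * #(p.drawSet C a) := by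
  classical
  set T := typeClass (p.Q (p.μ (p.cls a))) with hT
  let near : SeqType k V → (Fin n → X) → Finset (Fin n → X) := fun j z =>
    {x ∈ T | p.d (jointType x z) ≤ p.Δ j}
  -- `Cond` allows one centre per class. A centre with the largest neighbourhood dominates every
  -- actual codeword, which avoids proving that all neighbourhoods have equal size.
  have hmax : ∀ j, ∃ z ∈ typeClass (p.Q (p.μ j)), ∀ z' ∈ typeClass (p.Q (p.μ j)),
      #(near j z') ≤ #(near j z) := fun j =>
    exists_max_image _ (fun z => #(near j z)) (typeClass_nonempty _)
  choose xt hxt hxt_max using hmax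
  have hc := hcond (p.μ (p.cls a)) xt hxt
  have hsplit : #T ≤ #(p.drawSet C a) + ∑ j, #(typeClass j) * #(near j (xt j)) := by
    have h1 : T ⊆ p.drawSet C a ∪ (univ.filter (· < a)).biUnion fun b => near (p.cls b) (C b) := by
      intro x hx
      rw [mem_union, mem_drawSet]
      by_cases h : ∀ b, b < a → max (p.Δ (p.cls a)) (p.Δ (p.cls b)) < p.d (jointType (C b) x)
      · exact Or.inl ⟨hx, h⟩
      · push Not at h
        obtain ⟨b, hb, hd⟩ := h
        rw [max_threshold_eq hΔ hb, p.d_symm] at hd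
        exact Or.inr (mem_biUnion.2 ⟨b, by simpa using hb, mem_filter.2 ⟨hx, hd⟩⟩)
    refine (card_le_card h1).trans ((card_union_le _ _).trans (Nat.add_le_add_left ?_ _))
    refine card_biUnion_le.trans ?_
    -- The sum is enlarged from the earlier messages to all messages, then grouped by source type to
    -- match `Cond`.
    calc ∑ b with b < a, #(near (p.cls b) (C b))
        ≤ ∑ b with b < a, #(near (p.cls b) (xt (p.cls b))) := by
          refine sum_le_sum fun b hb => hxt_max _ _ ?_
          exact ((mem_drawSet p).1 (hC b (by simpa using hb))).1
      _ ≤ ∑ b, #(near (p.cls b) (xt (p.cls b))) :=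
          sum_le_univ_sum_of_nonneg fun _ => Nat.zero_le _
      _ = ∑ v : Fin k → V, #(near (typeOf v) (xt (typeOf v))) :=
          Equiv.sum_comp p.enum fun v => #(near (typeOf v) (xt (typeOf v)))
      _ = ∑ j, #(typeClass j) * #(near j (xt j)) := by
          rw [← sum_fiberwise univ (typeOf (α := V) (n := k))]
          refine sum_congr rfl fun j _ => ?_
          rw [← smul_eq_mul, ← sum_const]
          refine sum_congr (by ext v; simp [typeClass]) fun v hv => ?_
          have := mem_typeClass.1 hv
          rw [show typeOf v = j from Subtype.ext this]
  have hsplit' : (#T : ℝ) ≤ #(p.drawSet C a) +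
      ∑ j, (#(typeClass j) : ℝ) * #(near j (xt j)) := by exact_mod_cast hsplit
  have hc' : ∑ j, (#(typeClass j) : ℝ) * #(near j (xt j)) ≤
      p.zeta * #T * Real.exp (-(n * δ)) := by
    refine le_trans (le_of_eq (sum_congr rfl fun j _ => ?_)) hc
    rw [sum_const, nsmul_eq_mul, mul_comm]
  have : p.zeta * #T * Real.exp (-(n * δ)) ≤ 1 / 2 * #T := by
    calc _ = (p.zeta * Real.exp (-(n * δ))) * #T := by ring
      _ ≤ _ := by gcongr
  linarith

theorem drawSet_nonempty
    (hΔ : ∀ i j, p.rank i < p.rank j → p.Δ j ≤ p.Δ i) {δ : ℝ} (hcond : p.Cond δ)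
    (hhalf : p.zeta * Real.exp (-(n * δ)) ≤ 1 / 2) (C : Codebook V X n k)
    (a : Fin (Fintype.card (Fin k → V))) (hC : ∀ b < a, C b ∈ p.drawSet C b) :
    (p.drawSet C a).Nonempty := by
  have h := card_typeClass_le_two_mul_card_drawSet hΔ hcond hhalf C a hC
  have h2 : (0 : ℝ) < #(typeClass (p.Q (p.μ (p.cls a)))) := by
    exact_mod_cast (typeClass_nonempty _).card_pos
  rw [← card_pos]
  have : (0 : ℝ) < #(p.drawSet C a) := by linarith
  exact_mod_cast this

theorem inv_card_drawSet_le
    (hΔ : ∀ i j, p.rank i < p.rank j → p.Δ j ≤ p.Δ i) {δ : ℝ} (hcond : p.Cond δ)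
    (hhalf : p.zeta * Real.exp (-(n * δ)) ≤ 1 / 2) (C : Codebook V X n k)
    (a : Fin (Fintype.card (Fin k → V))) (hC : ∀ b < a, C b ∈ p.drawSet C b) :
    (#(p.drawSet C a) : ℝ)⁻¹ ≤ 2 * (#(typeClass (p.Q (p.μ (p.cls a)))) : ℝ)⁻¹ := by
  have h := card_typeClass_le_two_mul_card_drawSet hΔ hcond hhalf C a hC
  have h2 : (0 : ℝ) < #(typeClass (p.Q (p.μ (p.cls a)))) := by
    exact_mod_cast (typeClass_nonempty _).card_pos
  have h3 : (0 : ℝ) < #(p.drawSet C a) := by linarith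
  rw [← div_eq_mul_inv, le_div_iff₀ h2, inv_mul_le_iff₀ h3]
  linarith

theorem cls_symm (v : Fin k → V) : p.cls (p.enum.symm v) = typeOf v := by
  simp [cls]

theorem nonempty_sequences (p : Params V X m n k) (v : Fin k → V) : Nonempty (Fin n → X) :=
  (typeClass_nonempty (p.Q (p.μ (typeOf v)))).to_type

/-- Total mass 1 expresses that the construction never runs out: mass is lost precisely at reachable
histories with an empty draw set. -/
theorem sum_codebookProb_eq_one [Nonempty (Fin n → X)]
    (hΔ : ∀ i j, p.rank i < p.rank j → p.Δ j ≤ p.Δ i) {δ : ℝ} (hcond : p.Cond δ)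
    (hhalf : p.zeta * Real.exp (-(n * δ)) ≤ 1 / 2) :
    ∑ C, p.codebookProb C = 1 := by
  simp only [codebookProb_eq_drawWeight]
  exact sum_drawWeight_eq_one p.drawSet_congr (drawSet_nonempty hΔ hcond hhalf) le_rfl

theorem sum_codebookProb_codeword_le [DecidableEq (Fin n → X)]
    (hΔ : ∀ i j, p.rank i < p.rank j → p.Δ j ≤ p.Δ i) {δ : ℝ} (hcond : p.Cond δ)
    (hhalf : p.zeta * Real.exp (-(n * δ)) ≤ 1 / 2)
    (v : Fin k → V) (x : Fin n → X) :
    ∑ C, p.codebookProb C * (if p.codeword C v = x then 1 else 0) ≤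
      2 * (#(typeClass (p.Q (p.μ (typeOf v)))) : ℝ)⁻¹ := by
  have := p.nonempty_sequences v
  simp only [codebookProb_eq_drawWeight]
  have h := sum_drawWeight_indicator_le p.drawSet_congr (drawSet_nonempty hΔ hcond hhalf)
    (inv_card_drawSet_le hΔ hcond hhalf) (p.enum.symm v) x
  rwa [cls_symm] at h

/-- Distinct codewords are approximately independent and equiprobable on their type classes. -/
theorem sum_codebookProb_codeword_pair_le [DecidableEq (Fin n → X)]
    (hΔ : ∀ i j, p.rank i < p.rank j → p.Δ j ≤ p.Δ i) {δ : ℝ} (hcond : p.Cond δ)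
    (hhalf : p.zeta * Real.exp (-(n * δ)) ≤ 1 / 2)
    {v v' : Fin k → V} (hv : v ≠ v') (x x' : Fin n → X) :
    ∑ C, p.codebookProb C *
        ((if p.codeword C v = x then 1 else 0) * (if p.codeword C v' = x' then 1 else 0)) ≤
      4 * (#(typeClass (p.Q (p.μ (typeOf v)))) : ℝ)⁻¹ *
        (#(typeClass (p.Q (p.μ (typeOf v')))) : ℝ)⁻¹ := by
  have := p.nonempty_sequences v
  simp only [codebookProb_eq_drawWeight]
  have h := sum_drawWeight_pair_le p.drawSet_congr (drawSet_nonempty hΔ hcond hhalf)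
    (fun _ => by positivity) (inv_card_drawSet_le hΔ hcond hhalf)
    (p.enum.symm.injective.ne hv) x x'
  rw [cls_symm, cls_symm] at h
  exact h.trans (le_of_eq (by ring))

theorem codebookProb_nonneg (p : Params V X m n k) (C : Codebook V X n k) :
    0 ≤ p.codebookProb C := by
  rw [codebookProb_eq_drawWeight]; exact drawWeight_nonneg _ _ _

theorem mem_drawSet_of_codebookProb_ne_zero {C : Codebook V X n k} (h : p.codebookProb C ≠ 0)
    (a : Fin (Fintype.card (Fin k → V))) : C a ∈ p.drawSet C a := by
  rw [codebookProb_eq_drawWeight] at h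
  exact mem_of_drawWeight_ne_zero h a a.2

theorem codeword_mem_typeClass {C : Codebook V X n k} (h : p.codebookProb C ≠ 0)
    (v : Fin k → V) : p.codeword C v ∈ typeClass (p.Q (p.μ (typeOf v))) := by
  have := ((mem_drawSet p).1 (mem_drawSet_of_codebookProb_ne_zero h (p.enum.symm v))).1
  rwa [cls_symm] at this

/-- The later of the two codewords was drawn away from the earlier one; symmetry of the distance
removes the dependence on the order. -/
theorem max_threshold_lt {C : Codebook V X n k} (h : p.codebookProb C ≠ 0)
    {v v' : Fin k → V} (hv : v ≠ v') :
    max (p.Δ (typeOf v)) (p.Δ (typeOf v')) <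
      p.d (jointType (p.codeword C v) (p.codeword C v')) := by
  rcases (p.enum.symm.injective.ne hv).lt_or_gt with hlt | hlt
  · have := ((mem_drawSet p).1 (mem_drawSet_of_codebookProb_ne_zero h (p.enum.symm v'))).2 _ hlt
    rwa [cls_symm, cls_symm, max_comm] at this
  · have := ((mem_drawSet p).1 (mem_drawSet_of_codebookProb_ne_zero h (p.enum.symm v))).2 _ hlt
    rw [cls_symm, cls_symm] at this
    rwa [p.d_symm]

/-! ### Competing codewords behind a decoding error -/

section Error

variable {Y : Type*} [Fintype Y] {q : SeqType k V → (X × Y → ℝ) → EReal}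
  {dec : Codebook V X n k → (Fin n → Y) → (Fin k → V)}

/-- The joint type of two channel inputs and a channel output. -/
noncomputable abbrev tripleType {X Y : Type*} {n : ℕ} (x x' : Fin n → X) (y : Fin n → Y) :
    SeqType n (X × X × Y) :=
  typeOf fun s => (x s, x' s, y s)

/-- The competitor is the decoded message. The non-strict metric inequality in `Γ` covers every way
of breaking ties. -/
theorem exists_competitor (hdec : p.IsDecoder q dec) {C : Codebook V X n k}
    (h : p.codebookProb C ≠ 0) (y : Fin n → Y) (v : Fin k → V) (hv : dec C y ≠ v) :
    ∃ j, ∃ P ∈ p.Γ q (typeOf v) j, ∃ v', v ≠ v' ∧ typeOf v' = j ∧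
      tripleType (p.codeword C v) (p.codeword C v') y = P := by
  refine ⟨typeOf (dec C y), _, ?_, dec C y, hv.symm, rfl, rfl⟩
  refine ⟨?_, ?_, ?_, ?_⟩
  · exact (margin_empType _ _).trans (mem_typeClass.1 (codeword_mem_typeClass h v))
  · exact (margin_empType _ _).trans (mem_typeClass.1 (codeword_mem_typeClass h (dec C y)))
  · simp only [tripleType, typeOf, margin_empType]
    exact (max_threshold_lt h hv.symm).le
  · simp only [tripleType, typeOf, margin_empType]
    exact hdec C y v

theorem margin_margin_snd {α β γ : Type*} [Fintype α] [Fintype β] [Fintype γ] {n : ℕ}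
    {P : SeqType n (α × β × γ)} :
    margin Prod.snd (margin (fun z : α × β × γ => (z.2.1, (z.1, z.2.2))) P.1) =
      margin (fun z => (z.1, z.2.2)) P.1 := by
  obtain ⟨P, w, rfl⟩ := P
  simp only [margin_empType]

/-- The number of `x'` such that `(x, x', y)` has the joint type `P`, bounded by its exponential
estimate. -/
noncomputable def shellBound {X Y : Type*} [Fintype X] [Fintype Y] {n : ℕ}
    (P : SeqType n (X × X × Y)) : ℝ :=
  Real.exp (-(n * ∑ z, margin (fun z => (z.2.1, (z.1, z.2.2))) P.1 z *
    Real.log (margin (fun z => (z.2.1, (z.1, z.2.2))) P.1 z /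
      margin (fun z => (z.1, z.2.2)) P.1 z.2)))

theorem card_tripleType_le {X Y : Type*} [Fintype X] [Fintype Y] {n : ℕ}
    [DecidableEq (SeqType n (X × X × Y))]
    (hn : 0 < n) (P : SeqType n (X × X × Y)) (x : Fin n → X) (y : Fin n → Y) :
    (#{x' | tripleType x x' y = P} : ℝ) ≤ shellBound P := by
  classical
  have h := card_jointType_le (α := X) hn
    (margin (fun z => (z.2.1, (z.1, z.2.2))) P.1) (fun s => (x s, y s))
  rw [margin_margin_snd] at h
  refine le_trans ?_ h
  norm_cast
  refine card_le_card fun x' hx' => ?_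
  simp only [mem_filter, mem_univ, true_and] at hx' ⊢
  rw [← hx']
  simp only [typeOf, margin_empType, jointType]

/-- The bound on the probability, over the code ensemble, that a given message has a given
codeword and some other message of type `j` produces the joint type `P`. -/
noncomputable def competitorBound (p : Params V X m n k) (i j : SeqType k V)
    (P : SeqType n (X × X × Y)) : ℝ :=
  4 * (#(typeClass (p.Q (p.μ i))) : ℝ)⁻¹ *
    min 1 (#(typeClass j) * shellBound P * (#(typeClass (p.Q (p.μ j))) : ℝ)⁻¹)

open Classical in
-- The event is empty unless `(x, y)` has the marginal type of `P`. Otherwise either the competitor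
-- is ignored, or a union bound over messages of class `j` and sequences in the shell is combined
-- with the pair estimate.
theorem sum_codebookProb_competitor_le (hn : 0 < n)
    (hΔ : ∀ i j, p.rank i < p.rank j → p.Δ j ≤ p.Δ i) {δ : ℝ} (hcond : p.Cond δ)
    (hhalf : p.zeta * Real.exp (-(n * δ)) ≤ 1 / 2)
    (v : Fin k → V) (j : SeqType k V) (P : SeqType n (X × X × Y)) (x : Fin n → X)
    (y : Fin n → Y) :
    ∑ C, p.codebookProb C * ((if p.codeword C v = x then 1 else 0) *
        (if ∃ v', v ≠ v' ∧ typeOf v' = j ∧ tripleType x (p.codeword C v') y = P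
          then 1 else 0)) ≤
      if jointType x y = margin (fun z => (z.1, z.2.2)) P.1 then
        p.competitorBound (typeOf v) j P else 0 := by
  set E : Codebook V X n k → Prop := fun C =>
    ∃ v', v ≠ v' ∧ typeOf v' = j ∧ tripleType x (p.codeword C v') y = P with hE
  split_ifs with hP
  swap
  · refine (sum_eq_zero fun C _ => ?_).le
    have : ¬ E C := by
      rintro ⟨v', -, -, rfl⟩
      exact hP (by simp only [tripleType, typeOf, margin_empType, jointType])
    rw [if_neg this]; ring
  have hprob := p.codebookProb_nonneg
  have h1 : ∑ C, p.codebookProb C * ((if p.codeword C v = x then 1 else 0) *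
      (if E C then 1 else 0)) ≤ 2 * (#(typeClass (p.Q (p.μ (typeOf v)))) : ℝ)⁻¹ := by
    refine le_trans (sum_le_sum fun C _ => ?_)
      (sum_codebookProb_codeword_le hΔ hcond hhalf v x)
    refine mul_le_mul_of_nonneg_left ?_ (hprob C)
    split_ifs <;> norm_num
  have h2 : ∑ C, p.codebookProb C * ((if p.codeword C v = x then 1 else 0) *
      (if E C then 1 else 0)) ≤ 4 * (#(typeClass (p.Q (p.μ (typeOf v)))) : ℝ)⁻¹ *
        (#(typeClass j) * shellBound P * (#(typeClass (p.Q (p.μ j))) : ℝ)⁻¹) := by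
    have hu : ∀ C, (if E C then (1 : ℝ) else 0) ≤ ∑ v' ∈ typeClass j with v ≠ v',
        ∑ x' with tripleType x x' y = P, if p.codeword C v' = x' then 1 else 0 := by
      intro C
      have h0 : ∀ v' ∈ (typeClass j).filter (v ≠ ·), (0 : ℝ) ≤
          ∑ x' with tripleType x x' y = P, if p.codeword C v' = x' then 1 else 0 :=
        fun v' _ => sum_nonneg fun _ _ => by split_ifs <;> norm_num
      split_ifs with hEC
      · obtain ⟨v', hv', hj, hP'⟩ := hEC
        refine le_trans ?_ (single_le_sum h0 (mem_filter.2 ⟨by simp [typeClass, hj], hv'⟩))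
        refine le_trans ?_ (single_le_sum (fun _ _ => by split_ifs <;> norm_num)
          (mem_filter.2 ⟨mem_univ (p.codeword C v'), hP'⟩))
        simp
      · exact sum_nonneg h0
    calc _ ≤ ∑ C, p.codebookProb C * ((if p.codeword C v = x then 1 else 0) *
          ∑ v' ∈ typeClass j with v ≠ v', ∑ x' with tripleType x x' y = P,
            if p.codeword C v' = x' then 1 else 0) := by
          refine sum_le_sum fun C _ => mul_le_mul_of_nonneg_left ?_ (hprob C)
          exact mul_le_mul_of_nonneg_left (hu C) (by split_ifs <;> norm_num)
      _ = ∑ v' ∈ typeClass j with v ≠ v', ∑ x' with tripleType x x' y = P,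
            ∑ C, p.codebookProb C * ((if p.codeword C v = x then 1 else 0) *
              (if p.codeword C v' = x' then 1 else 0)) := by
          simp only [mul_sum]
          rw [sum_comm]
          exact sum_congr rfl fun _ _ => sum_comm
      _ ≤ ∑ v' ∈ typeClass j with v ≠ v', ∑ x' with tripleType x x' y = P,
            4 * (#(typeClass (p.Q (p.μ (typeOf v)))) : ℝ)⁻¹ *
              (#(typeClass (p.Q (p.μ j))) : ℝ)⁻¹ := by
          refine sum_le_sum fun v' hv' => sum_le_sum fun x' _ => ?_
          have h := sum_codebookProb_codeword_pair_le hΔ hcond hhalf (mem_filter.1 hv').2 x x'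
          have hj : typeOf v' = j := Subtype.ext (mem_typeClass.1 (mem_filter.1 hv').1)
          rwa [hj] at h
      _ ≤ #(typeClass j) * (shellBound P * (4 * (#(typeClass (p.Q (p.μ (typeOf v)))) : ℝ)⁻¹ *
              (#(typeClass (p.Q (p.μ j))) : ℝ)⁻¹)) := by
          simp only [sum_const, nsmul_eq_mul]
          have := card_tripleType_le hn P x y
          have h3 : (#((typeClass j).filter (v ≠ ·)) : ℝ) ≤ #(typeClass j) := by
            exact_mod_cast card_filter_le _ _
          gcongr
      _ = _ := by ring
  rw [competitorBound]
  rcases min_cases (1 : ℝ)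
    (#(typeClass j) * shellBound P * (#(typeClass (p.Q (p.μ j))) : ℝ)⁻¹) with h | h
  · rw [h.1]
    refine h1.trans ?_
    have : (0 : ℝ) ≤ (#(typeClass (p.Q (p.μ (typeOf v)))) : ℝ)⁻¹ := by positivity
    linarith
  · rw [h.1]; exact h2

end Error

end Params

/-- The joint type of `(X, Y)` when `(X, X̄, Y)` has joint type `P`. -/
noncomputable def inputOutputType {X Y : Type*} [Fintype X] [Fintype Y] {n : ℕ}
    (P : SeqType n (X × X × Y)) : SeqType n (X × Y) :=
  ⟨margin (fun z => (z.1, z.2.2)) P.1, by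
    obtain ⟨P, w, rfl⟩ := P
    exact ⟨_, (margin_empType _ w).symm⟩⟩

/-- Brings the codebook sum innermost, so that the ensemble average is taken with input, output and
joint type fixed. -/
theorem sum_reorder {ι₁ ι₂ ι₃ κ : Type*} {σ : κ → Type*} (s₁ : Finset ι₁) (s₂ : Finset ι₂)
    (s₃ : Finset ι₃) (t : Finset κ) (u : ∀ j, Finset (σ j))
    (f : ι₁ → ι₂ → ι₃ → (j : κ) → σ j → ℝ) :
    ∑ a ∈ s₁, ∑ b ∈ s₂, ∑ c ∈ s₃, ∑ j ∈ t, ∑ P ∈ u j, f a b c j P =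
      ∑ j ∈ t, ∑ P ∈ u j, ∑ c ∈ s₃, ∑ b ∈ s₂, ∑ a ∈ s₁, f a b c j P := by
  rw [sum_sigma' t u fun j P => ∑ c ∈ s₃, ∑ b ∈ s₂, ∑ a ∈ s₁, f a b c j P]
  simp only [fun a b c => sum_sigma' t u fun j P => f a b c j P]
  calc _ = ∑ a ∈ s₁, ∑ z ∈ t.sigma u, ∑ b ∈ s₂, ∑ c ∈ s₃, f a b c z.1 z.2 :=
        sum_congr rfl fun a _ =>
          (sum_congr rfl fun b _ => sum_comm).trans sum_comm
    _ = ∑ z ∈ t.sigma u, ∑ a ∈ s₁, ∑ b ∈ s₂, ∑ c ∈ s₃, f a b c z.1 z.2 := sum_comm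
    _ = _ := sum_congr rfl fun z _ =>
        ((sum_congr rfl fun a _ => sum_comm).trans sum_comm).trans
          (sum_congr rfl fun c _ => sum_comm)

/-! ### The averaged error as a sum over source types and joint types -/

namespace Params

variable {V X Y : Type*} [Fintype V] [Fintype X] [Fintype Y] {m n k : ℕ} {p : Params V X m n k}
  {q : SeqType k V → (X × Y → ℝ) → EReal} {dec : Codebook V X n k → (Fin n → Y) → (Fin k → V)}

open Classical in
theorem avgError_le {PV : V → ℝ} (hPV : ∀ a, 0 ≤ PV a) {W : X → Y → ℝ}
    (hW : ∀ x y, 0 ≤ W x y) (hn : 0 < n) (hdec : p.IsDecoder q dec)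
    (hΔ : ∀ i j, p.rank i < p.rank j → p.Δ j ≤ p.Δ i) {δ : ℝ} (hcond : p.Cond δ)
    (hhalf : p.zeta * Real.exp (-(n * δ)) ≤ 1 / 2) :
    p.avgError PV W dec ≤ ∑ i, ∑ j, ∑ P with P ∈ p.Γ q i j,
      (∑ v ∈ typeClass i, ∏ s, PV (v s)) *
        ((∑ w ∈ typeClass (inputOutputType P), ∏ s, W (w s).1 (w s).2) *
          p.competitorBound i j P) := by
  have hprob := p.codebookProb_nonneg
  have hPVk : ∀ v : Fin k → V, 0 ≤ ∏ s, PV (v s) := fun v => prod_nonneg fun s _ => hPV _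
  have hWn : ∀ (x : Fin n → X) (y : Fin n → Y), 0 ≤ ∏ s, W (x s) (y s) :=
    fun x y => prod_nonneg fun s _ => hW _ _
  let E : Codebook V X n k → (Fin k → V) → SeqType k V → SeqType n (X × X × Y) →
      (Fin n → X) → (Fin n → Y) → Prop := fun C v j P x y =>
    ∃ v', v ≠ v' ∧ typeOf v' = j ∧ tripleType x (p.codeword C v') y = P
  -- Restricted to codebooks of positive probability: the others may violate the type and distance
  -- constraints of `Γ`.
  have herr : ∀ C v y, p.codebookProb C ≠ 0 → (if dec C y ≠ v then (1 : ℝ) else 0) ≤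
      ∑ j, ∑ P with P ∈ p.Γ q (typeOf v) j, if E C v j P (p.codeword C v) y then 1 else 0 := by
    intro C v y hC
    have h0 : ∀ j ∈ (univ : Finset (SeqType k V)), (0 : ℝ) ≤ ∑ P with P ∈ p.Γ q (typeOf v) j,
        if E C v j P (p.codeword C v) y then 1 else 0 :=
      fun j _ => sum_nonneg fun _ _ => by split_ifs <;> norm_num
    split_ifs with hv
    · obtain ⟨j, P, hP, hE⟩ := exists_competitor hdec hC y v hv
      refine le_trans ?_ (single_le_sum h0 (mem_univ j))
      refine le_trans ?_ (single_le_sum (fun _ _ => by split_ifs <;> norm_num)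
        (mem_filter.2 ⟨mem_univ P, hP⟩))
      rw [if_pos hE]
    · exact sum_nonneg h0
  calc p.avgError PV W dec
      ≤ ∑ C, p.codebookProb C * ∑ v, (∏ s, PV (v s)) * ∑ y,
          (∏ s, W (p.codeword C v s) (y s)) * ∑ j, ∑ P with P ∈ p.Γ q (typeOf v) j,
            if E C v j P (p.codeword C v) y then 1 else 0 := by
        refine sum_le_sum fun C _ => ?_
        by_cases hC : p.codebookProb C = 0
        · simp [hC]
        refine mul_le_mul_of_nonneg_left (sum_le_sum fun v _ => ?_) (hprob C)
        refine mul_le_mul_of_nonneg_left (sum_le_sum fun y _ => ?_) (hPVk v)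
        exact mul_le_mul_of_nonneg_left (herr C v y hC) (hWn _ y)
    -- Inserting the value `x` of the sent codeword frees the channel factor from the codebook.
    _ = ∑ C, p.codebookProb C * ∑ v, (∏ s, PV (v s)) * ∑ y, ∑ x,
          (∏ s, W (x s) (y s)) * ∑ j, ∑ P with P ∈ p.Γ q (typeOf v) j,
            ((if p.codeword C v = x then 1 else 0) * if E C v j P x y then 1 else 0) := by
        refine sum_congr rfl fun C _ => ?_
        congr 1
        refine sum_congr rfl fun v _ => ?_
        congr 1
        refine sum_congr rfl fun y _ => ?_
        rw [sum_eq_single (p.codeword C v)]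
        · simp only [if_true, one_mul]
        · intro x _ hx
          simp [hx.symm]
        · simp
    _ = ∑ v, (∏ s, PV (v s)) * ∑ j, ∑ P with P ∈ p.Γ q (typeOf v) j, ∑ x, ∑ y,
          (∏ s, W (x s) (y s)) * ∑ C, p.codebookProb C *
            ((if p.codeword C v = x then 1 else 0) * if E C v j P x y then 1 else 0) := by
        simp only [mul_sum]
        rw [sum_comm]
        refine sum_congr rfl fun v _ => ?_
        rw [sum_reorder]
        refine sum_congr rfl fun j _ => sum_congr rfl fun P _ => sum_congr rfl fun x _ =>
          sum_congr rfl fun y _ => sum_congr rfl fun C _ => ?_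
        ring
    _ ≤ ∑ v, (∏ s, PV (v s)) * ∑ j, ∑ P with P ∈ p.Γ q (typeOf v) j, ∑ x, ∑ y,
          (∏ s, W (x s) (y s)) * if jointType x y = margin (fun z => (z.1, z.2.2)) P.1 then
            p.competitorBound (typeOf v) j P else 0 := by
        refine sum_le_sum fun v _ => mul_le_mul_of_nonneg_left ?_ (hPVk v)
        refine sum_le_sum fun j _ => sum_le_sum fun P _ => sum_le_sum fun x _ =>
          sum_le_sum fun y _ => mul_le_mul_of_nonneg_left ?_ (hWn x y)
        exact sum_codebookProb_competitor_le hn hΔ hcond hhalf v j P x y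
    _ = ∑ v, (∏ s, PV (v s)) * ∑ j, ∑ P with P ∈ p.Γ q (typeOf v) j,
          (∑ w ∈ typeClass (inputOutputType P), ∏ s, W (w s).1 (w s).2) *
            p.competitorBound (typeOf v) j P := by
        refine sum_congr rfl fun v _ => ?_
        congr 1
        refine sum_congr rfl fun j _ => sum_congr rfl fun P _ => ?_
        -- Pairs `(x, y)` become single sequences over `X × Y`, so the joint-type condition selects
        -- one type class.
        rw [← Fintype.sum_prod_type', ← Equiv.sum_comp (Equiv.arrowProdEquivProdArrow _ _ _),
          sum_mul, typeClass, sum_filter]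
        refine sum_congr rfl fun w _ => ?_
        have : jointType ((Equiv.arrowProdEquivProdArrow (Fin n) (fun _ => X) (fun _ => Y)) w).1
            ((Equiv.arrowProdEquivProdArrow (Fin n) (fun _ => X) (fun _ => Y)) w).2 =
            margin (fun z => (z.1, z.2.2)) P.1 ↔ typeOf w = inputOutputType P := by
          rw [Subtype.ext_iff]; rfl
        simp only [this]
        split_ifs <;> simp [Equiv.arrowProdEquivProdArrow]
    _ = _ := by
        rw [← sum_fiberwise univ (typeOf (α := V) (n := k))]
        refine sum_congr rfl fun i _ => ?_
        rw [sum_congr (s₂ := typeClass i) (by ext v; simp [typeClass])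
          (g := fun v => (∏ s, PV (v s)) * ∑ j, ∑ P with P ∈ p.Γ q i j,
            (∑ w ∈ typeClass (inputOutputType P), ∏ s, W (w s).1 (w s).2) *
              p.competitorBound i j P)]
        · rw [← sum_mul, mul_sum]
          exact sum_congr rfl fun j _ => mul_sum _ _ _
        · intro v hv
          have hv' : typeOf v = i := Subtype.ext (mem_typeClass.1 hv)
          subst hv'
          rfl

end Params

/-! ### From counts to the exponent -/

theorem le_margin {α β : Type*} [Fintype α] {P : α → ℝ} (hP : ∀ a, 0 ≤ P a) (f : α → β) (a : α) :
    P a ≤ margin f P (f a) := by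
  classical
  unfold margin
  exact single_le_sum (f := P) (fun b _ => hP b) (mem_filter.2 ⟨mem_univ a, rfl⟩)

theorem sum_margin_mul {α β : Type*} [Fintype α] [Fintype β] (f : α → β) (P : α → ℝ)
    (g : β → ℝ) : ∑ a, P a * g (f a) = ∑ b, margin f P b * g b := by
  classical
  rw [← sum_fiberwise univ f]
  refine sum_congr rfl fun b _ => ?_
  rw [margin, sum_mul]
  exact sum_congr rfl fun a ha => by rw [(mem_filter.1 ha).2]

/-- This is `I(A;B) = H(A) - H(A|B)`: the first term measures the shell, the second the type class
of the codeword. -/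
theorem mutualInfo_eq_add_entropy {α β : Type*} [Fintype α] [Fintype β] {P : α × β → ℝ}
    (hP : ∀ z, 0 ≤ P z) :
    mutualInfo P =
      ∑ z, P z * Real.log (P z / margin Prod.snd P z.2) + entropy (margin Prod.fst P) := by
  have h := sum_margin_mul Prod.fst P fun a => Real.log (margin Prod.fst P a)
  have h2 : entropy (margin Prod.fst P) =
      -∑ z, P z * Real.log (margin Prod.fst P z.1) := by
    rw [h]; simp [entropy, Real.negMulLog]
  rw [h2, ← sub_eq_add_neg, ← sum_sub_distrib, mutualInfo]
  refine sum_congr rfl fun z _ => ?_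
  rcases (hP z).eq_or_lt with h0 | h0
  · simp [← h0]
  · have h3 := h0.trans_le (le_margin hP Prod.fst z)
    have h4 := h0.trans_le (le_margin hP Prod.snd z)
    rw [Real.log_div h0.ne' (mul_pos h3 h4).ne', Real.log_mul h3.ne' h4.ne',
      Real.log_div h0.ne' h4.ne']
    ring

theorem inv_card_typeClass_le {α : Type*} [Fintype α] {n : ℕ} (hn : 0 < n) (Q : SeqType n α) :
    (#(typeClass Q) : ℝ)⁻¹ ≤
      (Real.exp 1 * (n + 1)) ^ Fintype.card α * Real.exp (-(n * entropy Q.1)) := by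
  have h : (0 : ℝ) < #(typeClass Q) := by exact_mod_cast (typeClass_nonempty Q).card_pos
  rw [Real.exp_neg, ← div_eq_mul_inv, le_div_iff₀ (Real.exp_pos _), inv_mul_le_iff₀ h,
    mul_comm (#(typeClass Q) : ℝ)]
  exact exp_entropy_le hn Q

namespace Params

variable {V X Y : Type*} [Fintype V] [Fintype X] [Fintype Y] {m n k : ℕ} {p : Params V X m n k}
  {q : SeqType k V → (X × Y → ℝ) → EReal}

/-- The shell occupies a fraction about `exp (-nI)` of the type class, and there are at most `exp
(nR_j)` messages of class `j`; truncation at 1 yields the positive part. -/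
theorem competitorBound_le (hn : 0 < n) (hk : 0 < k) {i j : SeqType k V}
    {P : SeqType n (X × X × Y)} (hP : P ∈ p.Γ q i j) :
    p.competitorBound i j P ≤ 4 * ((Real.exp 1 * (n + 1)) ^ Fintype.card X) ^ 2 *
      (Real.exp (-(n * entropy (p.Q (p.μ i)).1)) * Real.exp (-(n *
        max (mutualInfo (margin (fun z => (z.2.1, (z.1, z.2.2))) P.1) - p.R j) 0))) := by
  set c := (Real.exp 1 * ((n : ℝ) + 1)) ^ Fintype.card X with hc
  have hn0 : (0 : ℝ) < n := by exact_mod_cast hn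
  have hk0 : (0 : ℝ) < k := by exact_mod_cast hk
  -- Needed when the truncation is active, where the bound 1 must be absorbed into `c`.
  have hc1 : 1 ≤ c := by
    refine one_le_pow₀ ?_
    nlinarith [Real.add_one_le_exp (1 : ℝ)]
  set I := mutualInfo (margin (fun z => (z.2.1, (z.1, z.2.2))) P.1) with hI
  have hI' : shellBound P * Real.exp (-(n * entropy (p.Q (p.μ j)).1)) = Real.exp (-(n * I)) := by
    have h0 : ∀ z, 0 ≤ margin (fun z => (z.2.1, (z.1, z.2.2))) P.1 z := by
      obtain ⟨P, w, rfl⟩ := P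
      intro z
      rw [margin_empType]
      exact empType_nonneg _ _
    have hQ : margin Prod.fst (margin (fun z => (z.2.1, (z.1, z.2.2))) P.1) =
        (p.Q (p.μ j)).1 := by
      rw [← hP.2.1]
      obtain ⟨P, w, rfl⟩ := P
      simp only [margin_empType]
    rw [hI, mutualInfo_eq_add_entropy h0, margin_margin_snd, hQ, shellBound, ← Real.exp_add]
    congr 1
    ring
  have hR : (n : ℝ) * p.R j = k * entropy j.1 := by
    rw [R, rate]; field_simp
  have hmin : min 1 (#(typeClass j) * shellBound P * (#(typeClass (p.Q (p.μ j))) : ℝ)⁻¹) ≤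
      c * Real.exp (-(n * max (I - p.R j) 0)) := by
    rcases max_cases (I - p.R j) 0 with h | h
    · rw [h.1]
      refine (min_le_right _ _).trans ?_
      have hs : 0 ≤ shellBound P := (Real.exp_pos _).le
      calc _ ≤ Real.exp (k * entropy j.1) * shellBound P *
            (c * Real.exp (-(n * entropy (p.Q (p.μ j)).1))) :=
            mul_le_mul (mul_le_mul_of_nonneg_right (card_typeClass_le hk j) hs)
              (inv_card_typeClass_le hn _) (by positivity) (by positivity)
        _ = c * (Real.exp (k * entropy j.1) *
            (shellBound P * Real.exp (-(n * entropy (p.Q (p.μ j)).1)))) := by ring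
        _ = _ := by
          rw [hI', ← Real.exp_add, ← hR]
          congr 2; ring
    · rw [h.1]
      refine (min_le_left _ _).trans ?_
      simpa using hc1
  rw [competitorBound]
  calc _ ≤ 4 * (c * Real.exp (-(n * entropy (p.Q (p.μ i)).1))) *
        (c * Real.exp (-(n * max (I - p.R j) 0))) := by
        refine mul_le_mul ?_ hmin ?_ (by positivity)
        · exact mul_le_mul_of_nonneg_left (inv_card_typeClass_le hn _) (by norm_num)
        · exact le_min zero_le_one (mul_nonneg (mul_nonneg (by positivity)
            (Real.exp_pos _).le) (by positivity))
    _ = _ := by ring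

/-- The exponent bounds the product of the probability of a source type, of a channel event and
of a competitor. -/
theorem exp_mul_exp_mul_exp_le (PV : V → ℝ) (W : X → Y → ℝ) (hn : 0 < n) (hk : 0 < k)
    {i j : SeqType k V} {P : SeqType n (X × X × Y)} (hP : P ∈ p.Γ q i j)
    (hi : i.1 ∈ stdSimplex ℝ V) :
    EReal.exp (-((k : EReal) * relEntropy i.1 PV)) *
      (EReal.exp (-((n : EReal) * relEntropy (inputOutputType P).1
          (fun z => (p.Q (p.μ i)).1 z.1 * W z.1 z.2))) *
        ENNReal.ofReal (Real.exp (-(n *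
          max (mutualInfo (margin (fun z => (z.2.1, (z.1, z.2.2))) P.1) - p.R j) 0)))) ≤
      EReal.exp (-((n : EReal) * p.exponent q PV W i j)) := by
  have hn0 : (0 : ℝ) < n := by exact_mod_cast hn
  have hk0 : (0 : ℝ) < k := by exact_mod_cast hk
  have hrate : 0 < p.rate := div_pos hk0 hn0
  set r := max (mutualInfo (margin (fun z => (z.2.1, (z.1, z.2.2))) P.1) - p.R j) 0 with hr
  have htop : ∀ l : ℕ, 0 < l → EReal.exp (-((l : EReal) * ⊤)) = 0 := by
    intro l hl
    rw [EReal.mul_top_of_pos (by exact_mod_cast hl), EReal.neg_top, EReal.exp_bot]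
  have hexp : p.exponent q PV W i j ≤ (p.rate : EReal) * relEntropy i.1 PV +
      (relEntropy (inputOutputType P).1 (fun z => (p.Q (p.μ i)).1 z.1 * W z.1 z.2) + (r : ℝ)) := by
    refine add_le_add ?_ (iInf₂_le P hP)
    refine mul_le_mul_of_nonneg_left ?_ (by exact_mod_cast hrate.le)
    -- The source type `i` is itself admissible in the minimum defining `e`, since its entropy
    -- equals `R_i / t`.
    refine iInf₂_le i.1 ⟨hi, ?_⟩
    rw [R, mul_div_cancel_left₀ _ hrate.ne']
  have hmono : EReal.exp (-((n : EReal) * ((p.rate : EReal) * relEntropy i.1 PV +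
      (relEntropy (inputOutputType P).1 (fun z => (p.Q (p.μ i)).1 z.1 * W z.1 z.2) + (r : ℝ))))) ≤
      EReal.exp (-((n : EReal) * p.exponent q PV W i j)) := by
    refine EReal.exp_monotone (EReal.neg_le_neg_iff.2 ?_)
    exact mul_le_mul_of_nonneg_left hexp (by exact_mod_cast hn0.le)
  refine le_trans ?_ hmono
  -- If both divergences are finite the exponents agree because `k = n t`; otherwise the left side
  -- is 0.
  unfold relEntropy
  split_ifs with h1 h2
  · generalize (∑ a, i.1 a * Real.log (i.1 a / PV a)) = D₁
    generalize (∑ a, (inputOutputType P).1 a * _) = D₂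
    rw [← EReal.exp_coe, ← EReal.exp_add, ← EReal.exp_add]
    refine le_of_eq (congrArg _ ?_)
    have : -((n : ℝ) * (p.rate * D₁ + (D₂ + r))) = -(k * D₁) + (-(n * D₂) + -(n * r)) := by
      rw [rate]; field_simp; ring
    have h := congrArg (fun x : ℝ => (x : EReal)) this
    push_cast at h ⊢
    exact h.symm
  · rw [htop n hn]; simp
  · rw [htop k hk]; simp
  · rw [htop k hk]; simp

theorem ofReal_avgError_le {PV : V → ℝ} (hPV : ∀ a, 0 ≤ PV a) {W : X → Y → ℝ}
    (hW : ∀ x y, 0 ≤ W x y) (hn : 0 < n) (hk : 0 < k)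
    {dec : Codebook V X n k → (Fin n → Y) → (Fin k → V)} (hdec : p.IsDecoder q dec)
    (hΔ : ∀ i j, p.rank i < p.rank j → p.Δ j ≤ p.Δ i) {δ : ℝ} (hcond : p.Cond δ)
    (hhalf : p.zeta * Real.exp (-(n * δ)) ≤ 1 / 2) :
    ENNReal.ofReal (p.avgError PV W dec) ≤
      ENNReal.ofReal (((n : ℝ) + 1) ^ Fintype.card (X × X × Y) *
        (4 * ((Real.exp 1 * (n + 1)) ^ Fintype.card X) ^ 2)) * p.bound q PV W := by
  classical
  set K : ℝ := 4 * ((Real.exp 1 * (n + 1)) ^ Fintype.card X) ^ 2 with hK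
  have hK0 : 0 ≤ K := by positivity
  clear_value K
  have hPVk : ∀ v : Fin k → V, 0 ≤ ∏ s, PV (v s) := fun v => prod_nonneg fun s _ => hPV _
  have hWn : ∀ w : Fin n → X × Y, 0 ≤ ∏ s, W (w s).1 (w s).2 :=
    fun w => prod_nonneg fun s _ => hW _ _
  have hterm : ∀ i j P, P ∈ p.Γ q i j → ENNReal.ofReal ((∑ v ∈ typeClass i, ∏ s, PV (v s)) *
        ((∑ w ∈ typeClass (inputOutputType P), ∏ s, W (w s).1 (w s).2) *
          p.competitorBound i j P)) ≤
      ENNReal.ofReal K * EReal.exp (-((n : EReal) * p.exponent q PV W i j)) := by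
    intro i j P hP
    have hi : i.1 ∈ stdSimplex ℝ V := by
      obtain ⟨_, v, rfl⟩ := i
      exact ⟨empType_nonneg v, sum_empType hk v⟩
    refine le_trans ?_ (mul_le_mul_right (exp_mul_exp_mul_exp_le PV W hn hk hP hi) _)
    -- The factor `exp (-nH(Q))` is the `Q`-probability of any input of type `Q`; it turns the
    -- channel sum into the `Q × W`-probability of a joint type class.
    have hchan : (∑ w ∈ typeClass (inputOutputType P), ∏ s, W (w s).1 (w s).2) *
        Real.exp (-(n * entropy (p.Q (p.μ i)).1)) =
        ∑ w ∈ typeClass (inputOutputType P),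
          ∏ s, (fun z : X × Y => (p.Q (p.μ i)).1 z.1 * W z.1 z.2) (w s) := by
      rw [sum_mul]
      refine sum_congr rfl fun w hw => ?_
      have hw1 : empType (fun s => (w s).1) = (p.Q (p.μ i)).1 := by
        rw [← margin_empType Prod.fst w, mem_typeClass.1 hw, ← hP.1]
        obtain ⟨P, w, rfl⟩ := P
        simp only [inputOutputType, margin_empType]
      rw [prod_mul_distrib, mul_comm]
      congr 1
      rw [prod_comp_eq_exp hn (fun s => (w s).1) (p.Q (p.μ i)).1
        (fun s => hw1 ▸ empType_pos (fun s => (w s).1) s), hw1]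
      simp only [entropy, Real.negMulLog, neg_mul, sum_neg_distrib, mul_neg, neg_neg]
    have hQ0 : ∀ a, 0 ≤ (p.Q (p.μ i)).1 a := by
      obtain ⟨x, hx⟩ := (p.Q (p.μ i)).2
      rw [← hx]; exact empType_nonneg x
    set r := max (mutualInfo (margin (fun z => (z.2.1, (z.1, z.2.2))) P.1) - p.R j) 0
    set A := ∑ v ∈ typeClass i, ∏ s, PV (v s)
    set B := ∑ w ∈ typeClass (inputOutputType P), ∏ s, W (w s).1 (w s).2
    have hA : 0 ≤ A := sum_nonneg fun v _ => hPVk v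
    have hB : 0 ≤ B := sum_nonneg fun w _ => hWn w
    have hreal : A * (B * p.competitorBound i j P) ≤
        K * (A * ((B * Real.exp (-(n * entropy (p.Q (p.μ i)).1))) * Real.exp (-(n * r)))) := by
      calc _ ≤ A * (B * (K * (Real.exp (-(n * entropy (p.Q (p.μ i)).1)) *
            Real.exp (-(n * r))))) := by
            have := competitorBound_le hn hk hP
            rw [← hK] at this
            gcongr
        _ = _ := by ring
    refine (ENNReal.ofReal_le_ofReal hreal).trans ?_
    rw [ENNReal.ofReal_mul hK0, ENNReal.ofReal_mul hA, ENNReal.ofReal_mul (by positivity), hchan]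
    refine mul_le_mul_right (mul_le_mul' (sum_typeClass_prod_le hk i hPV) (mul_le_mul_left ?_ _)) _
    exact sum_typeClass_prod_le hn _ fun z => mul_nonneg (hQ0 _) (hW _ _)
  have h0 : ∀ i j P, 0 ≤ (∑ v ∈ typeClass i, ∏ s, PV (v s)) *
        ((∑ w ∈ typeClass (inputOutputType P), ∏ s, W (w s).1 (w s).2) *
          p.competitorBound i j P) := by
    intro i j P
    refine mul_nonneg (sum_nonneg fun v _ => hPVk v) (mul_nonneg (sum_nonneg fun w _ => hWn w) ?_)
    have : 0 ≤ shellBound P := (Real.exp_pos _).le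
    unfold competitorBound
    positivity
  refine (ENNReal.ofReal_le_ofReal (avgError_le hPV hW hn hdec hΔ hcond hhalf)).trans ?_
  rw [ENNReal.ofReal_sum_of_nonneg
    fun i _ => sum_nonneg fun j _ => sum_nonneg fun P _ => h0 i j P, bound, mul_sum]
  refine sum_le_sum fun i _ => ?_
  rw [ENNReal.ofReal_sum_of_nonneg fun j _ => sum_nonneg fun P _ => h0 i j P, mul_sum]
  refine sum_le_sum fun j _ => ?_
  rw [ENNReal.ofReal_sum_of_nonneg fun P _ => h0 i j P]
  refine (sum_le_sum fun P hP => hterm i j P (mem_filter.1 hP).2).trans ?_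
  rw [sum_const, nsmul_eq_mul, ENNReal.ofReal_mul (by positivity), mul_assoc]
  refine mul_le_mul_left ?_ _
  rw [← ENNReal.ofReal_natCast]
  refine ENNReal.ofReal_le_ofReal ?_
  have h := (card_filter_le (univ : Finset (SeqType n (X × X × Y))) (· ∈ p.Γ q i j)).trans
    (card_univ.trans_le card_seqType_le)
  exact_mod_cast h

end Params

/-! ### Polynomial factors in the limit -/

theorem tendsto_add_one_pow_mul_exp_neg (b : ℕ) {δ : ℝ} (hδ : 0 < δ) :
    Tendsto (fun n : ℕ => ((n : ℝ) + 1) ^ b * Real.exp (-(n * δ))) atTop (nhds 0) := by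
  have h := (Real.tendsto_pow_mul_exp_neg_atTop_nhds_zero b).comp
    ((tendsto_natCast_atTop_atTop (R := ℝ)).atTop_add tendsto_const_nhds (C := 1)
      |>.atTop_mul_const hδ)
  have h2 := h.mul_const (Real.exp δ / δ ^ b)
  rw [zero_mul] at h2
  refine h2.congr fun n => ?_
  simp only [Function.comp]
  rw [mul_pow, show -((n : ℝ) * δ) = -(((n : ℝ) + 1) * δ) + δ by ring, Real.exp_add]
  field_simp

theorem tendsto_log_const_mul_pow_div {c : ℝ} (hc : 0 < c) (b : ℕ) :
    Tendsto (fun n : ℕ => Real.log (c * ((n : ℝ) + 1) ^ b) / n) atTop (nhds 0) := by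
  have h1 : Tendsto (fun n : ℕ => Real.log c / (n : ℝ)) atTop (nhds 0) :=
    tendsto_const_div_atTop_nhds_zero_nat _
  have h2 : Tendsto (fun n : ℕ => Real.log ((n : ℝ) + 1) / n) atTop (nhds 0) := by
    have := (Real.tendsto_pow_log_div_mul_add_atTop 1 (-1) 1 one_ne_zero).comp
      ((tendsto_natCast_atTop_atTop (R := ℝ)).atTop_add tendsto_const_nhds (C := 1))
    refine this.congr fun n => ?_
    simp
  have h3 := h1.add (h2.const_mul (b : ℝ))
  simp only [mul_zero, add_zero] at h3
  refine h3.congr fun n => ?_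
  rw [Real.log_mul hc.ne' (by positivity), Real.log_pow]
  ring

/-- Boundedness of `k / n` enters here: it makes the number of source types, hence `ζ`, polynomial
in `n`. -/
theorem eventually_zeta_mul_exp_le {V X : Type*} [Fintype V] [Fintype X] {m : ℕ} {n k : ℕ → ℕ}
    (hn : Tendsto n atTop atTop) (hn0 : ∀ l, 0 < n l) {T : ℝ} (hT : ∀ l, (k l : ℝ) / n l ≤ T)
    (p : ∀ l, Params V X m (n l) (k l)) {δ : ℝ} (hδ : 0 < δ) :
    ∀ᶠ l in atTop, (p l).zeta * Real.exp (-(n l * δ)) ≤ 1 / 2 := by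
  have hT0 : 0 ≤ T := le_trans (by positivity) (hT 0)
  set a := Fintype.card V
  set b := Fintype.card X ^ 2 + Fintype.card X with hb
  have h := ((tendsto_add_one_pow_mul_exp_neg (a + b) hδ).comp hn).const_mul ((T + 1) ^ a)
  rw [mul_zero] at h
  filter_upwards [h.eventually_le_const (show (0 : ℝ) < 1 / 2 by norm_num)] with l hl
  refine le_trans ?_ hl
  have hnl : (0 : ℝ) < n l := by exact_mod_cast hn0 l
  have hk : (k l : ℝ) + 1 ≤ (T + 1) * (n l + 1) := by
    have := (div_le_iff₀ hnl).1 (hT l)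
    nlinarith
  have hcard : (Fintype.card (SeqType (k l) V) : ℝ) ≤ ((T + 1) * (n l + 1)) ^ a := by
    refine le_trans (b := ((k l : ℝ) + 1) ^ a) ?_ (by gcongr)
    exact_mod_cast card_seqType_le (n := k l) (α := V)
  simp only [Function.comp]
  calc (p l).zeta * Real.exp (-(n l * δ))
      ≤ (((T + 1) * (n l + 1)) ^ a * ((n l : ℝ) + 1) ^ b) * Real.exp (-(n l * δ)) := by
        rw [Params.zeta]
        gcongr
    _ = _ := by rw [mul_pow, pow_add]; ring

theorem expLE_of_eventually_le {n : ℕ → ℕ} (hn : Tendsto n atTop atTop)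
    {f g : ℕ → ENNReal} {c : ℝ} (hc : 0 < c) (b : ℕ)
    (h : ∀ᶠ l in atTop, f l ≤ ENNReal.ofReal (c * ((n l : ℝ) + 1) ^ b) * g l) : ExpLE n f g := by
  have hlim : Tendsto (fun l => ((Real.log (c * ((n l : ℝ) + 1) ^ b) / n l : ℝ) : EReal)) atTop
      (nhds 0) := EReal.tendsto_coe.2 ((tendsto_log_const_mul_pow_div hc b).comp hn)
  rw [ExpLE, ← hlim.limsup_eq]
  refine limsup_le_limsup (h.mono fun l hl => ?_)
  have hpos : 0 < c * ((n l : ℝ) + 1) ^ b := by positivity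
  have h1 : ENNReal.log (f l / g l) ≤ (Real.log (c * ((n l : ℝ) + 1) ^ b) : ℝ) := by
    rw [← ENNReal.log_ofReal_of_pos hpos]
    -- The quotient bound also holds when `g l = 0`: then `f l = 0`, and `0 / 0 = 0`.
    exact ENNReal.log_monotone (ENNReal.div_le_of_le_mul hl)
  simp only [EReal.coe_div, EReal.coe_natCast]
  exact EReal.div_le_div_right_of_nonneg (by positivity) h1

end RGV

theorem theorem1 {V X Y : Type*} [Fintype V] [Fintype X] [Fintype Y]
    (PV : V → ℝ) (hPV : PV ∈ stdSimplex ℝ V)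
    (W : X → Y → ℝ) (hW : ∀ x, W x ∈ stdSimplex ℝ Y)
    (m : ℕ) (n k : ℕ → ℕ)
    (hn : Filter.Tendsto n Filter.atTop Filter.atTop) (hn0 : ∀ l, 0 < n l)
    (hk0 : ∀ l, 0 < k l)
    (T : ℝ) (hT : ∀ l, (k l : ℝ) / n l ≤ T)
    (p : ∀ l, RGV.Params V X m (n l) (k l))
    (hΔ : ∀ l i j, (p l).rank i < (p l).rank j → (p l).Δ j ≤ (p l).Δ i)
    (δ : ℝ) (hδ : 0 < δ) (hcond : ∀ l, (p l).Cond δ)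
    (q : ∀ l, RGV.SeqType (k l) V → (X × Y → ℝ) → EReal)
    (dec : ∀ l, RGV.Codebook V X (n l) (k l) → (Fin (n l) → Y) → (Fin (k l) → V))
    (hdec : ∀ l, (p l).IsDecoder (q l) (dec l)) :
    (∀ᶠ l in Filter.atTop, ∑ C, (p l).codebookProb C = 1) ∧
    RGV.ExpLE n (fun l => ENNReal.ofReal ((p l).avgError PV W (dec l)))
      (fun l => (p l).bound (q l) PV W) := by
  have hhalf := RGV.eventually_zeta_mul_exp_le hn hn0 hT p hδ
  have hV : Nonempty V := by
    by_contra hV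
    rw [not_nonempty_iff] at hV
    simpa using hPV.2
  constructor
  · filter_upwards [hhalf] with l hl
    have := (p l).nonempty_sequences fun _ => hV.some
    exact RGV.Params.sum_codebookProb_eq_one (hΔ l) (hcond l) hl
  · refine RGV.expLE_of_eventually_le hn
      -- One power of `n + 1` per letter of `X × X × Y` counts the joint types; the remaining `2
      -- |X|` powers, like the powers of `e`, come from the sizes of the two codeword type classes,
      -- and 4 from the pair estimate.
      (c := 4 * (Real.exp 1 ^ Fintype.card X) ^ 2) (by positivity)
      (Fintype.card (X × X × Y) + 2 * Fintype.card X) (hhalf.mono fun l hl => ?_)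
    refine (RGV.Params.ofReal_avgError_le hPV.1 (fun x => (hW x).1) (hn0 l) (hk0 l) (hdec l)
      (hΔ l) (hcond l) hl).trans (le_of_eq ?_)
    congr 2
    rw [mul_pow, pow_add]
    ring
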